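/- **The system $\mathbf{CNF}^{\iota\prime}$.** Fix constants, predicate letters with numbers of places, and infinitely many parameters $a,b,\dots$ (free variables, distinct from the bound variables $x,y,\dots$). Terms and formulas are generated simultaneously: terms are constants, parameters (these two are the *atomic* terms) and definite descriptions $\iota xF$; formulas are $Rt_1\dots t_n$, $\exists!t$, $t=u$ (these three are *atomic*, and *prime* if all their terms are atomic), $\bot$, $A\to B$, $\forall xA$; $\neg A$ is $A\to\bot$. Formulas are taken up to renaming of bound variables, and $A^x_t$ is the result of replacing all free occurrences of $x$ in $A$ by $t$, also inside $\iota$-terms. Deductions are finite trees of formulas built from assumptions, which belong to labelled assumption classes (vacuous discharge is allowed), by the rules * $(\to I)$: from $B$ infer $A\to B$, discharging a class of $A$; $(\to E)$: from $A\to B$ and $A$ infer $B$; * $(\bot E_C)$: from $\bot$ infer an atomic $A$, discharging a class of $\neg A$; if the discharge is vacuous, $A$ must be prime; * $(\forall I)$: from $A^x_a$ infer $\forall xA$, discharging a class of $\exists!a$; $(\forall E)$: from $\forall xA$ and $\exists!t$ infer $A^x_t$, $t$ atomic; * $(=I^{nG})$: from $\exists!t$ (major premise) and $C$ (minor premise)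 infer $C$, discharging above the minor premise a class of $a=t$; $(=E)$: from $t_1=t_2$ (major premise) and $A^x_{t_1}$ (minor premise) infer $A^x_{t_2}$, $A$ atomic; * $(AD)$: from $Rt_1\dots t_n$ infer $\exists!t_i$, for $R$ a predicate letter or $=$; * $(\iota I)$: from $\exists!t$, $F^x_a$, $a=t$ infer $\iota xF=t$, $t$ atomic, discharging a class of $a=t$ above the second premise and classes of $F^x_a$ and of $\exists!a$ above the third; * $(\iota E_1)$: from $\iota xF=t$ and $u=t$ infer $F^x_u$; $(\iota E_2)$: from $\iota xF=t$, $F^x_u$ and $\exists!u$ infer $u=t$ ($t,u$ atomic in both); $(\iota E_3)$: from $\iota xF=t$ infer $\exists!t$ (every such instance of $(AD)$ counts as $(\iota E_3)$). In $(\forall I)$, $(=I^{nG})$, $(\iota I)$ the parameter $a$ does not occur in $\forall xA$, in $t$ and $C$, in $\iota xF$ and $t$, respectively, nor in the open assumptions of the subdeduction of the premise of $(\forall I)$, of the minor premise of $(=I^{nG})$, of the premises of $(\iota I)$, other than those the rule discharges. **Normal form.** The elimination rules are $(\to E)$, $(\forall E)$, $(\iota E_1)$, $(\iota E_2)$, $(\iota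 E_3)$, with the leftmost premise as major premise; the introduction rules are $(\to I)$, $(\forall I)$, $(\iota I)$, $(=I^{nG})$. A *segment* is a sequence $A_1,\dots,A_n$ ($n\ge1$) of formula occurrences of one of two kinds. First kind: each $A_i$, $i<n$, is the minor premise of an application of $(=I^{nG})$ with conclusion $A_{i+1}$; $A_1$ is not the conclusion and $A_n$ not the minor premise of $(=I^{nG})$. Second kind: each $A_i$, $i<n$, is the minor premise of an application of $(\to E)$ whose major premise is an assumption discharged by an application of $(\bot E_C)$ with conclusion $A_{i+1}$; $A_1$ is not the conclusion of $(\bot E_C)$, and $A_n$ is not a minor premise of an $(\to E)$ whose major premise is discharged by $(\bot E_C)$. An *$(=E)$-segment* is a sequence $\sigma_1,\dots,\sigma_m$ of segments such that the last formula of $\sigma_i$ ($i<m$) is the minor premise of an $(=E)$ whose conclusion is the first formula of $\sigma_{i+1}$, where $\sigma_1$ is minor premise but not conclusion of $(=E)$ and $\sigma_m$ is conclusion but not minor premise of $(=E)$. In what follows $(AD)$ includes $(\iota E_3)$. The *maximal* segments are: 1. segments whose last formula is the major premise of an elimination rule and which, if of length $1$, are the conclusion of an introduction rule; segments whose last formula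 is the conclusion of $(\bot E_C)$ and the major premise of an elimination rule or the premise of $(AD)$; 2. segments of formulas $t=t$ one of which is the minor premise of $(=I^{nG})$ and the last of which is the premise of $(AD)$; segments of formulas $a=t$ the first of which is an assumption discharged by an application of $(=I^{nG})$ with parameter $a$ and the last of which is the premise of $(AD)$ with conclusion $\exists!t$; 3. segments of formulas $\exists!t$ the first of which is concluded by $(AD)$ from $t=t$ and the last of which is the major premise of $(=I^{nG})$ with conclusion $t=t$; 4. $(=E)$-segments whose last segment is the premise of $(AD)$ or all of whose formulas have the form $\exists!t$. A deduction is in *normal form* if it contains no maximal segments and no vacuous application of $(=E)$, i.e. none whose minor premise and conclusion are the same formula. It is *regular* if every assumption discharged by $(\bot E_C)$ is the major premise of $(\to E)$. **Theorem.** Deductions in $\mathbf{CNF}^{\iota\prime}$ can be brought into normal form: for every deduction in $\mathbf{CNF}^{\iota\prime}$ there is a deduction in $\mathbf{CNF}^{\iota\prime}$ with the same conclusion, with all its open assumption classes among those of the given deduction, which is regular and in normal form. -/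

import Mathlib

namespace NFL

universe u v

/-- A signature: constants and predicate letters with their numbers of places. -/
structure Sig where
  Con : Type u
  Pred : Type v
  ar : Pred → ℕ

mutual
/-- Terms in which at most the bound variables `0, …, n-1` are loose (de Bruijn indices; the variable
of the innermost operator is `0`).  Parameters are numbered by `ℕ`.  The terms of the language are
the elements of `Tm S 0`. -/
inductive Tm (S : Sig.{u, v}) : ℕ → Type (max u v)
  | bv {n : ℕ} (k : Fin n) : Tm S n
  | par {n : ℕ} (a : ℕ) : Tm S n
  | con {n : ℕ} (c : S.Con) : Tm S n
  | iota {n : ℕ} (F : Fml S (n + 1)) : Tm S n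
/-- Formulas in which at most the bound variables `0, …, n-1` are loose.  The formulas of the
language are the elements of `Fml S 0`; `ex t` is the existence predicate applied to `t`. -/
inductive Fml (S : Sig.{u, v}) : ℕ → Type (max u v)
  | bot {n : ℕ} : Fml S n
  | pred {n : ℕ} (P : S.Pred) (ts : Fin (S.ar P) → Tm S n) : Fml S n
  | ex {n : ℕ} (t : Tm S n) : Fml S n
  | eq {n : ℕ} (s t : Tm S n) : Fml S n
  | imp {n : ℕ} (A B : Fml S n) : Fml S n
  | all {n : ℕ} (A : Fml S (n + 1)) : Fml S n
end

variable {S : Sig.{u, v}}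

/-- A renaming of loose variables, carried under one variable-binding operator. -/
def liftRen {m n : ℕ} (f : Fin m → Fin n) : Fin (m + 1) → Fin (n + 1) :=
  Fin.cases 0 (fun k => (f k).succ)

mutual
/-- Renaming of loose variables in a term. -/
def Tm.ren : {m : ℕ} → Tm S m → {n : ℕ} → (Fin m → Fin n) → Tm S n
  | _, .bv k, _, f => .bv (f k)
  | _, .par a, _, _ => .par a
  | _, .con c, _, _ => .con c
  | _, .iota F, _, f => .iota (F.ren (liftRen f))
/-- Renaming of loose variables in a formula. -/
def Fml.ren : {m : ℕ} → Fml S m → {n : ℕ} → (Fin m → Fin n) → Fml S n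
  | _, .bot, _, _ => .bot
  | _, .pred P ts, _, f => .pred P (fun k => (ts k).ren f)
  | _, .ex t, _, f => .ex (t.ren f)
  | _, .eq s t, _, f => .eq (s.ren f) (t.ren f)
  | _, .imp A B, _, f => .imp (A.ren f) (B.ren f)
  | _, .all A, _, f => .all (A.ren (liftRen f))
end

/-- A substitution for loose variables, carried under one variable-binding operator. -/
def liftSub {m n : ℕ} (f : Fin m → Tm S n) : Fin (m + 1) → Tm S (n + 1) :=
  Fin.cases (.bv 0) (fun k => (f k).ren Fin.succ)

mutual
/-- Capture-free substitution of terms for the loose variables of a term. -/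
def Tm.subst : {m : ℕ} → Tm S m → {n : ℕ} → (Fin m → Tm S n) → Tm S n
  | _, .bv k, _, f => f k
  | _, .par a, _, _ => .par a
  | _, .con c, _, _ => .con c
  | _, .iota F, _, f => .iota (F.subst (liftSub f))
/-- Capture-free substitution of terms for the loose variables of a formula. -/
def Fml.subst : {m : ℕ} → Fml S m → {n : ℕ} → (Fin m → Tm S n) → Fml S n
  | _, .bot, _, _ => .bot
  | _, .pred P ts, _, f => .pred P (fun k => (ts k).subst f)
  | _, .ex t, _, f => .ex (t.subst f)
  | _, .eq s t, _, f => .eq (s.subst f) (t.subst f)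
  | _, .imp A B, _, f => .imp (A.subst f) (B.subst f)
  | _, .all A, _, f => .all (A.subst (liftSub f))
end

/-- `A.inst t` replaces all free occurrences of the one loose variable of `A` by the term `t`
(also those inside definite descriptions). -/
def Fml.inst (A : Fml S 1) (t : Tm S 0) : Fml S 0 := A.subst (fun _ => t)

/-- Negation is defined. -/
def Fml.neg {n : ℕ} (A : Fml S n) : Fml S n := .imp A .bot

mutual
/-- The parameter `a` occurs in the term. -/
def Tm.HasPar (a : ℕ) : {n : ℕ} → Tm S n → Prop
  | _, .bv _ => False
  | _, .par b => b = a
  | _, .con _ => False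
  | _, .iota F => F.HasPar a
/-- The parameter `a` occurs in the formula. -/
def Fml.HasPar (a : ℕ) : {n : ℕ} → Fml S n → Prop
  | _, .bot => False
  | _, .pred _ ts => ∃ k, (ts k).HasPar a
  | _, .ex t => t.HasPar a
  | _, .eq s t => s.HasPar a ∨ t.HasPar a
  | _, .imp A B => A.HasPar a ∨ B.HasPar a
  | _, .all A => A.HasPar a
end

/-- Atomic terms: everything but definite descriptions. -/
def Tm.IsAtomic {n : ℕ} : Tm S n → Prop
  | .iota _ => False
  | _ => True

/-- Atomic formulas: formed from terms by predicate letters, the existence predicate, identity. -/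
def Fml.IsAtomic {n : ℕ} : Fml S n → Prop
  | .pred _ _ => True
  | .ex _ => True
  | .eq _ _ => True
  | _ => False

/-- Prime formulas: atomic formulas all of whose terms are atomic. -/
def Fml.IsPrime {n : ℕ} : Fml S n → Prop
  | .pred _ ts => ∀ k, (ts k).IsAtomic
  | .ex t => t.IsAtomic
  | .eq s t => s.IsAtomic ∧ t.IsAtomic
  | _ => False

/-- `A` is `R t₁ … tₙ`, for `R` a predicate letter or identity, and `t` is one of the `tᵢ`. -/
def Fml.HasArg {n : ℕ} (t : Tm S n) : Fml S n → Prop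
  | .pred _ ts => ∃ k, ts k = t
  | .eq s u => t = s ∨ t = u
  | _ => False

/-- Instances of the rules.  The numerals `i j k` are the labels of the assumption classes that are
discharged; an assumption class is a label together with a formula.  Making an assumption is the
rule `asm`. -/
inductive Rule (S : Sig.{u, v}) : Type (max u v)
  | asm (i : ℕ) (A : Fml S 0)
  | impI (i : ℕ) (A B : Fml S 0)
  | impE (A B : Fml S 0)
  | botC (i : ℕ) (A : Fml S 0)
  | allI (i a : ℕ) (A : Fml S 1)
  | allE (A : Fml S 1) (t : Tm S 0)
  | eqI (i a : ℕ) (t : Tm S 0) (C : Fml S 0)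
  | eqE (A : Fml S 1) (s t : Tm S 0)
  | ad (A : Fml S 0) (t : Tm S 0)
  | iotaI (i j k a : ℕ) (F : Fml S 1) (t : Tm S 0)
  | iotaE₁ (F : Fml S 1) (t u : Tm S 0)
  | iotaE₂ (F : Fml S 1) (t u : Tm S 0)
  | iotaE₃ (F : Fml S 1) (t : Tm S 0)

namespace Rule

/-- The conclusion of a rule instance. -/
def concl : Rule S → Fml S 0
  | asm _ A => A
  | impI _ A B => .imp A B
  | impE _ B => B
  | botC _ A => A
  | allI _ _ A => .all A
  | allE A t => A.inst t
  | eqI _ _ _ C => C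
  | eqE A _ t => A.inst t
  | ad _ t => .ex t
  | iotaI _ _ _ _ F t => .eq (.iota F) t
  | iotaE₁ F _ u => F.inst u
  | iotaE₂ _ t u => .eq u t
  | iotaE₃ _ t => .ex t

/-- The premises of a rule instance, from left to right. -/
def prems : Rule S → List (Fml S 0)
  | asm _ _ => []
  | impI _ _ B => [B]
  | impE A B => [.imp A B, A]
  | botC _ _ => [.bot]
  | allI _ a A => [A.inst (.par a)]
  | allE A t => [.all A, .ex t]
  | eqI _ _ t C => [.ex t, C]
  | eqE A s t => [.eq s t, A.inst s]
  | ad A _ => [A]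
  | iotaI _ _ _ a F t => [.ex t, F.inst (.par a), .eq (.par a) t]
  | iotaE₁ F t u => [.eq (.iota F) t, .eq u t]
  | iotaE₂ F t u => [.eq (.iota F) t, F.inst u, .ex u]
  | iotaE₃ F t => [.eq (.iota F) t]

/-- The assumption classes that a rule instance discharges above its premise number `n`
(premises are counted from `0`). -/
def disch : Rule S → ℕ → Set (ℕ × Fml S 0)
  | impI i A _, 0 => {(i, A)}
  | botC i A, 0 => {(i, A.neg)}
  | allI i a _, 0 => {(i, .ex (.par a))}
  | eqI i a t _, 1 => {(i, .eq (.par a) t)}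
  | iotaI i _ _ a _ t, 1 => {(i, .eq (.par a) t)}
  | iotaI _ j k a F _, 2 => {(j, F.inst (.par a)), (k, .ex (.par a))}
  | _, _ => ∅

/-- The restricted parameter of a rule instance that must not occur in the open assumptions above
premise number `n`, other than those discharged by the instance. -/
def eigen : Rule S → ℕ → Option ℕ
  | allI _ a _, _ => some a
  | eqI _ a _ _, 1 => some a
  | iotaI _ _ _ a _ _, _ => some a
  | _, _ => none

/-- The conditions on a rule instance that concern only the instance itself. -/
def Ok : Rule S → Prop
  | botC _ A => A.IsAtomic
  | allI _ a A => ¬ A.HasPar a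
  | allE _ t => t.IsAtomic
  | eqI _ a t C => ¬ t.HasPar a ∧ ¬ C.HasPar a
  | eqE A _ _ => A.IsAtomic
  | ad A t => A.HasArg t ∧ ∀ F, A ≠ .eq (.iota F) t -- the excluded case is `iotaE₃`
  | iotaI _ _ _ a F t => t.IsAtomic ∧ ¬ F.HasPar a ∧ ¬ t.HasPar a
  | iotaE₁ _ t u => t.IsAtomic ∧ u.IsAtomic
  | iotaE₂ _ t u => t.IsAtomic ∧ u.IsAtomic
  | _ => True

/-- Introduction rules. -/
def IsIntro : Rule S → Prop
  | impI _ _ _ => True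
  | allI _ _ _ => True
  | eqI _ _ _ _ => True
  | iotaI _ _ _ _ _ _ => True
  | _ => False

/-- Elimination rules (for the connective, the quantifier and the description operator).  The major
premise is the leftmost one, number `0`. -/
def IsElim : Rule S → Prop
  | impE _ _ => True
  | allE _ _ => True
  | iotaE₁ _ _ _ => True
  | iotaE₂ _ _ _ => True
  | iotaE₃ _ _ => True
  | _ => False

/-- The rule of atomic denotation, including its special case `iotaE₃`. -/
def IsAD : Rule S → Prop
  | ad _ _ => True
  | iotaE₃ _ _ => True
  | _ => False

/-- Identity introduction (in its general form). -/
def IsEqI : Rule S → Prop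
  | eqI _ _ _ _ => True
  | _ => False

/-- Identity elimination. -/
def IsEqE : Rule S → Prop
  | eqE _ _ _ => True
  | _ => False

/-- Implication elimination. -/
def IsImpE : Rule S → Prop
  | impE _ _ => True
  | _ => False

/-- Classical reductio. -/
def IsBotC : Rule S → Prop
  | botC _ _ => True
  | _ => False

/-- Applications of identity elimination whose minor premise and conclusion are the same formula. -/
def IsVacuousEqE : Rule S → Prop
  | eqE A s t => A.inst s = A.inst t
  | _ => False

end Rule

/-- Trees of rule instances, with one subtree for each premise. -/
inductive Ded (S : Sig.{u, v}) : Type (max u v)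
  | node (r : Rule S) (ds : Fin r.prems.length → Ded S) : Ded S

/-- Positions in a tree: the sequence of premise numbers met on the way up from the root.  They serve
as names of formula occurrences. -/
abbrev Pos := List ℕ

namespace Ded

/-- The last rule. -/
def rule : Ded S → Rule S
  | node r _ => r

/-- The formula at the root. -/
def concl (D : Ded S) : Fml S 0 := D.rule.concl

/-- The open assumption classes. -/
def openAsm : Ded S → Set (ℕ × Fml S 0)
  | node r ds => {c | r = .asm c.1 c.2} ∪ ⋃ n, (openAsm (ds n) \ r.disch n)

/-- The tree is a deduction in the system: every premise is the conclusion of its subtree, the side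
conditions of the rules are met, and reductio with vacuous discharge has a prime conclusion. -/
def Correct : Ded S → Prop
  | node r ds =>
    (∀ n, Correct (ds n)) ∧ (∀ n, (ds n).concl = r.prems.get n) ∧ r.Ok ∧
    (∀ (n : Fin r.prems.length) (a : ℕ), r.eigen n = some a →
      ∀ c ∈ (ds n).openAsm, c ∉ r.disch n → ¬ c.2.HasPar a) ∧
    (∀ i A, r = .botC i A → A.IsPrime ∨ ∃ n, (i, A.neg) ∈ (ds n).openAsm)

/-- The subtree at a position. -/
def sub : Ded S → Pos → Option (Ded S)
  | D, [] => some D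
  | node r ds, n :: p => if h : n < r.prems.length then (ds ⟨n, h⟩).sub p else none

/-- The rule by which the occurrence at a position is concluded. -/
def ruleAt (D : Ded S) (p : Pos) : Option (Rule S) := (D.sub p).map rule

/-- The formula at a position. -/
def fmlAt (D : Ded S) (p : Pos) : Option (Fml S 0) := (D.ruleAt p).map Rule.concl

/-- The occurrence `p` is concluded by a rule with the property `R`. -/
def ConcludedBy (D : Ded S) (R : Rule S → Prop) (p : Pos) : Prop :=
  ∃ r, D.ruleAt p = some r ∧ R r

/-- The occurrence `p` is premise number `n` of a rule with the property `R`. -/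
def PremiseOf (D : Ded S) (n : ℕ) (R : Rule S → Prop) (p : Pos) : Prop :=
  ∃ q, p = q ++ [n] ∧ D.ConcludedBy R q

/-- The occurrence `p` is an assumption discharged by the rule application with conclusion `q`: this
application, and none in between, discharges its assumption class. -/
def DischargedAt (D : Ded S) (p q : Pos) : Prop :=
  ∃ i A, D.ruleAt p = some (.asm i A) ∧
    (∃ n s r, p = q ++ n :: s ∧ D.ruleAt q = some r ∧ (i, A) ∈ r.disch n) ∧
    ∀ q' n s r, p = q' ++ n :: s → D.ruleAt q' = some r → q.length < q'.length →
      (i, A) ∉ r.disch n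

/-- `p` is the minor premise, `q` the conclusion of an application of `eqI`. -/
def EqLink (D : Ded S) (p q : Pos) : Prop :=
  p = q ++ [1] ∧ D.ConcludedBy Rule.IsEqI q

/-- `p` is the minor premise of an application of `impE` the major premise of which is discharged by
the application of `botC` with conclusion `q`. -/
def BotLink (D : Ded S) (p q : Pos) : Prop :=
  ∃ p', p = p' ++ [1] ∧ D.ConcludedBy Rule.IsImpE p' ∧ D.DischargedAt (p' ++ [0]) q ∧
    D.ConcludedBy Rule.IsBotC q

/-- Segments arising from `eqI`. -/
def IsEqSegment (D : Ded S) (l : List Pos) : Prop :=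
  l.IsChain D.EqLink ∧
  (∃ p, l.head? = some p ∧ D.ConcludedBy (fun r => ¬ r.IsEqI) p) ∧
  (∃ p, l.getLast? = some p ∧ ∀ q, ¬ D.EqLink p q)

/-- Segments arising from `botC`. -/
def IsBotSegment (D : Ded S) (l : List Pos) : Prop :=
  l.IsChain D.BotLink ∧
  (∃ p, l.head? = some p ∧ D.ConcludedBy (fun r => ¬ r.IsBotC) p) ∧
  (∃ p, l.getLast? = some p ∧ ∀ q, ¬ D.BotLink p q)

/-- Segments of either kind. -/
def IsSegment (D : Ded S) (l : List Pos) : Prop := D.IsEqSegment l ∨ D.IsBotSegment l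

/-- Maximal segments in the sense of introduction and elimination, and of reductio followed by an
elimination rule or by the rule of atomic denotation. -/
def IsMaxIESegment (D : Ded S) (l : List Pos) : Prop :=
  D.IsSegment l ∧ ∃ p, l.getLast? = some p ∧
    ((D.PremiseOf 0 Rule.IsElim p ∧ (l.length = 1 → D.ConcludedBy Rule.IsIntro p)) ∨
     (D.ConcludedBy Rule.IsBotC p ∧
       (D.PremiseOf 0 Rule.IsElim p ∨ D.PremiseOf 0 Rule.IsAD p)))

/-- Maximal identity segments: (i) segments of formulas `t = t` one of which is minor premise of
`eqI` and the last of which is premise of the rule of atomic denotation; (ii) segments of formulas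
`a = t` the first of which is discharged by an application of `eqI` with restricted parameter `a` and
the last of which is premise of the rule of atomic denotation with conclusion `∃! t`. -/
def IsMaxEqSegment (D : Ded S) (l : List Pos) : Prop :=
  D.IsSegment l ∧
  ((∃ t, (∀ p ∈ l, D.fmlAt p = some (.eq t t)) ∧
      (∃ p ∈ l, D.PremiseOf 1 Rule.IsEqI p) ∧
      (∃ p, l.getLast? = some p ∧ D.PremiseOf 0 Rule.IsAD p)) ∨
   (∃ a t, (∀ p ∈ l, D.fmlAt p = some (.eq (.par a) t)) ∧
      (∃ p q, l.head? = some p ∧ D.DischargedAt p q ∧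
        D.ConcludedBy (fun r => ∃ i C, r = .eqI i a t C) q) ∧
      (∃ p, l.getLast? = some p ∧
        D.PremiseOf 0 (fun r => r.IsAD ∧ r.concl = .ex t) p)))

/-- Maximal existence segments: segments of formulas `∃! t` the first of which is concluded by the
rule of atomic denotation from `t = t`, and the last of which is the major premise of an application
of `eqI` with conclusion `t = t`. -/
def IsMaxExSegment (D : Ded S) (l : List Pos) : Prop :=
  D.IsSegment l ∧ ∃ t, (∀ p ∈ l, D.fmlAt p = some (.ex t)) ∧
    (∃ p, l.head? = some p ∧ D.ConcludedBy (fun r => r.IsAD ∧ r.prems = [.eq t t]) p) ∧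
    (∃ p, l.getLast? = some p ∧ D.PremiseOf 0 (fun r => r.IsEqI ∧ r.concl = .eq t t) p)

/-- The last formula of `l` is the minor premise, the first formula of `l'` the conclusion of an
application of `eqE`. -/
def EqELink (D : Ded S) (l l' : List Pos) : Prop :=
  ∃ q, l.getLast? = some (q ++ [1]) ∧ l'.head? = some q ∧ D.ConcludedBy Rule.IsEqE q

/-- `l` is minor premise of `eqE`. -/
def SegMinorEqE (D : Ded S) (l : List Pos) : Prop :=
  ∃ p, l.getLast? = some p ∧ D.PremiseOf 1 Rule.IsEqE p

/-- `l` is conclusion of `eqE`. -/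
def SegConclEqE (D : Ded S) (l : List Pos) : Prop :=
  ∃ p, l.head? = some p ∧ D.ConcludedBy Rule.IsEqE p

/-- Sequences of segments that are linked by applications of `eqE`, extended as far as possible in
both directions. -/
def IsEqESegment (D : Ded S) (L : List (List Pos)) : Prop :=
  (∀ l ∈ L, D.IsSegment l) ∧ L.IsChain D.EqELink ∧
  (∃ l, L.head? = some l ∧ D.SegMinorEqE l ∧ ¬ D.SegConclEqE l) ∧
  (∃ l, L.getLast? = some l ∧ D.SegConclEqE l ∧ ¬ D.SegMinorEqE l)

/-- Maximal `eqE`-segments: the last segment is premise of the rule of atomic denotation, or all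
formulas are formed by the existence predicate. -/
def IsMaxEqESegment (D : Ded S) (L : List (List Pos)) : Prop :=
  D.IsEqESegment L ∧
  ((∃ l p, L.getLast? = some l ∧ l.getLast? = some p ∧ D.PremiseOf 0 Rule.IsAD p) ∨
   (∀ l ∈ L, ∀ p ∈ l, ∃ t, D.fmlAt p = some (.ex t)))

/-- Normal form: no maximal segments of any kind, and no vacuous applications of `eqE`. -/
def Normal (D : Ded S) : Prop :=
  (∀ l, ¬ D.IsMaxIESegment l) ∧ (∀ l, ¬ D.IsMaxEqSegment l) ∧ (∀ l, ¬ D.IsMaxExSegment l) ∧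
  (∀ L, ¬ D.IsMaxEqESegment L) ∧ (∀ p, ¬ D.ConcludedBy Rule.IsVacuousEqE p)

/-- Regular deductions: every assumption discharged by `botC` is the major premise of `impE`. -/
def Regular (D : Ded S) : Prop :=
  ∀ p q, D.DischargedAt p q → D.ConcludedBy Rule.IsBotC q → D.PremiseOf 0 Rule.IsImpE p

end Ded

end NFL

/-! Normal deductions are obtained by evaluation instead of reduction. The formulas are
interpreted in a Kripke model whose worlds are the finite sets of assumption classes; absurdity,
and with it the double negation in front of atomic formulas, is derivability of `⊥` by a normal
deduction. The value of a term, at a world, is a set of atomic terms identical with it, so that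
the interpretation of a definite description is a condition on atomic terms, as the rules for `ι`
demand. All rules are sound in this model. Conversely, by induction on formulas, what is forced is
derivable by a normal deduction, and what is derivable by a neutral deduction, such as an open
assumption, is forced.

Among the normal deductions it suffices to consider those of a local shape, for which no maximal
segment has to be traced: `eqI` only concludes `⊥`, which excludes the detours through `t = t`,
and the classes discharged by `botC` and by `eqI` carry two labels that no open assumption of the
given deduction has, so that the last rule of a subdeduction shows what its conclusion may be used
for. -/

namespace NFL

universe u v

variable {S : Sig.{u, v}}

open Matrix (vecCons)

/-! ### Substitution -/

section Substitution

variable {m n k : ℕ}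

theorem liftRen_comp (f : Fin m → Fin n) (g : Fin n → Fin k) :
    liftRen g ∘ liftRen f = liftRen (g ∘ f) :=
  funext <| Fin.cases rfl fun _ => rfl

mutual

theorem Tm.ren_ren : ∀ {m : ℕ} (t : Tm S m) {n k : ℕ} (f : Fin m → Fin n) (g : Fin n → Fin k),
    (t.ren f).ren g = t.ren (g ∘ f)
  | _, .bv _, _, _, _, _ => rfl
  | _, .par _, _, _, _, _ => rfl
  | _, .con _, _, _, _, _ => rfl
  | _, .iota F, _, _, f, g => by simp only [Tm.ren, Fml.ren_ren F, liftRen_comp]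

theorem Fml.ren_ren : ∀ {m : ℕ} (A : Fml S m) {n k : ℕ} (f : Fin m → Fin n) (g : Fin n → Fin k),
    (A.ren f).ren g = A.ren (g ∘ f)
  | _, .bot, _, _, _, _ => rfl
  | _, .pred _ ts, _, _, f, g => by simp only [Fml.ren, fun i => Tm.ren_ren (ts i) f g]
  | _, .ex t, _, _, _, _ => by simp only [Fml.ren, Tm.ren_ren t]
  | _, .eq s t, _, _, _, _ => by simp only [Fml.ren, Tm.ren_ren s, Tm.ren_ren t]
  | _, .imp A B, _, _, _, _ => by simp only [Fml.ren, Fml.ren_ren A, Fml.ren_ren B]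
  | _, .all A, _, _, _, _ => by simp only [Fml.ren, Fml.ren_ren A, liftRen_comp]

end

theorem liftSub_comp_liftRen (f : Fin m → Fin n) (g : Fin n → Tm S k) :
    liftSub g ∘ liftRen f = liftSub (g ∘ f) :=
  funext <| Fin.cases rfl fun _ => rfl

mutual

theorem Tm.ren_subst : ∀ {m : ℕ} (t : Tm S m) {n k : ℕ} (f : Fin m → Fin n) (g : Fin n → Tm S k),
    (t.ren f).subst g = t.subst (g ∘ f)
  | _, .bv _, _, _, _, _ => rfl
  | _, .par _, _, _, _, _ => rfl
  | _, .con _, _, _, _, _ => rfl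
  | _, .iota F, _, _, f, g => by
    simp only [Tm.ren, Tm.subst, Fml.ren_subst F, liftSub_comp_liftRen]

theorem Fml.ren_subst : ∀ {m : ℕ} (A : Fml S m) {n k : ℕ} (f : Fin m → Fin n)
    (g : Fin n → Tm S k), (A.ren f).subst g = A.subst (g ∘ f)
  | _, .bot, _, _, _, _ => rfl
  | _, .pred _ ts, _, _, f, g => by
    simp only [Fml.ren, Fml.subst, fun i => Tm.ren_subst (ts i) f g]
  | _, .ex t, _, _, _, _ => by simp only [Fml.ren, Fml.subst, Tm.ren_subst t]
  | _, .eq s t, _, _, _, _ => by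
    simp only [Fml.ren, Fml.subst, Tm.ren_subst s, Tm.ren_subst t]
  | _, .imp A B, _, _, _, _ => by
    simp only [Fml.ren, Fml.subst, Fml.ren_subst A, Fml.ren_subst B]
  | _, .all A, _, _, _, _ => by
    simp only [Fml.ren, Fml.subst, Fml.ren_subst A, liftSub_comp_liftRen]

end

theorem liftSub_ren_liftRen (f : Fin m → Tm S n) (g : Fin n → Fin k) :
    (fun i => (liftSub f i).ren (liftRen g)) = liftSub fun i => (f i).ren g :=
  funext <| Fin.cases rfl fun i =>
    ((f i).ren_ren Fin.succ (liftRen g)).trans ((f i).ren_ren g Fin.succ).symm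

mutual

theorem Tm.subst_ren : ∀ {m : ℕ} (t : Tm S m) {n k : ℕ} (f : Fin m → Tm S n) (g : Fin n → Fin k),
    (t.subst f).ren g = t.subst fun i => (f i).ren g
  | _, .bv _, _, _, _, _ => rfl
  | _, .par _, _, _, _, _ => rfl
  | _, .con _, _, _, _, _ => rfl
  | _, .iota F, _, _, f, g => by
    simp only [Tm.ren, Tm.subst, Fml.subst_ren F, liftSub_ren_liftRen]

theorem Fml.subst_ren : ∀ {m : ℕ} (A : Fml S m) {n k : ℕ} (f : Fin m → Tm S n)
    (g : Fin n → Fin k), (A.subst f).ren g = A.subst fun i => (f i).ren g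
  | _, .bot, _, _, _, _ => rfl
  | _, .pred _ ts, _, _, f, g => by
    simp only [Fml.ren, Fml.subst, fun i => Tm.subst_ren (ts i) f g]
  | _, .ex t, _, _, _, _ => by simp only [Fml.ren, Fml.subst, Tm.subst_ren t]
  | _, .eq s t, _, _, _, _ => by
    simp only [Fml.ren, Fml.subst, Tm.subst_ren s, Tm.subst_ren t]
  | _, .imp A B, _, _, _, _ => by
    simp only [Fml.ren, Fml.subst, Fml.subst_ren A, Fml.subst_ren B]
  | _, .all A, _, _, _, _ => by
    simp only [Fml.ren, Fml.subst, Fml.subst_ren A, liftSub_ren_liftRen]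

end

theorem liftSub_subst_liftSub (f : Fin m → Tm S n) (g : Fin n → Tm S k) :
    (fun i => (liftSub f i).subst (liftSub g)) = liftSub fun i => (f i).subst g :=
  funext <| Fin.cases rfl fun i =>
    ((f i).ren_subst Fin.succ (liftSub g)).trans ((f i).subst_ren g Fin.succ).symm

mutual

theorem Tm.subst_subst : ∀ {m : ℕ} (t : Tm S m) {n k : ℕ} (f : Fin m → Tm S n)
    (g : Fin n → Tm S k), (t.subst f).subst g = t.subst fun i => (f i).subst g
  | _, .bv _, _, _, _, _ => rfl
  | _, .par _, _, _, _, _ => rfl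
  | _, .con _, _, _, _, _ => rfl
  | _, .iota F, _, _, f, g => by
    simp only [Tm.subst, Fml.subst_subst F, liftSub_subst_liftSub]

theorem Fml.subst_subst : ∀ {m : ℕ} (A : Fml S m) {n k : ℕ} (f : Fin m → Tm S n)
    (g : Fin n → Tm S k), (A.subst f).subst g = A.subst fun i => (f i).subst g
  | _, .bot, _, _, _, _ => rfl
  | _, .pred _ ts, _, _, f, g => by simp only [Fml.subst, fun i => Tm.subst_subst (ts i) f g]
  | _, .ex t, _, _, _, _ => by simp only [Fml.subst, Tm.subst_subst t]
  | _, .eq s t, _, _, _, _ => by simp only [Fml.subst, Tm.subst_subst s, Tm.subst_subst t]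
  | _, .imp A B, _, _, _, _ => by simp only [Fml.subst, Fml.subst_subst A, Fml.subst_subst B]
  | _, .all A, _, _, _, _ => by
    simp only [Fml.subst, Fml.subst_subst A, liftSub_subst_liftSub]

end

theorem liftSub_bv : liftSub (fun i : Fin n => (.bv i : Tm S n)) = fun i => .bv i :=
  funext <| Fin.cases rfl fun _ => rfl

mutual

theorem Tm.subst_bv : ∀ {n : ℕ} (t : Tm S n), t.subst (fun i => .bv i) = t
  | _, .bv _ => rfl
  | _, .par _ => rfl
  | _, .con _ => rfl
  | _, .iota F => by simp only [Tm.subst, liftSub_bv, Fml.subst_bv F]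

theorem Fml.subst_bv : ∀ {n : ℕ} (A : Fml S n), A.subst (fun i => .bv i) = A
  | _, .bot => rfl
  | _, .pred _ ts => by simp only [Fml.subst, fun i => Tm.subst_bv (ts i)]
  | _, .ex t => by simp only [Fml.subst, Tm.subst_bv t]
  | _, .eq s t => by simp only [Fml.subst, Tm.subst_bv s, Tm.subst_bv t]
  | _, .imp A B => by simp only [Fml.subst, Fml.subst_bv A, Fml.subst_bv B]
  | _, .all A => by simp only [Fml.subst, liftSub_bv, Fml.subst_bv A]

end

theorem Tm.subst_closed (t : Tm S 0) (f : Fin 0 → Tm S 0) : t.subst f = t := by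
  rw [Subsingleton.elim f fun i => .bv i, Tm.subst_bv]

theorem Fml.subst_closed (A : Fml S 0) (f : Fin 0 → Tm S 0) : A.subst f = A := by
  rw [Subsingleton.elim f fun i => .bv i, Fml.subst_bv]

/-- A term of the language, regarded as a term with one (vacuous) loose variable. -/
def Tm.wk (t : Tm S 0) : Tm S 1 := t.ren Fin.elim0

@[simp] theorem Tm.wk_subst (t : Tm S 0) (f : Fin 1 → Tm S 0) : t.wk.subst f = t := by
  rw [Tm.wk, Tm.ren_subst, Tm.subst_closed]

theorem Fml.subst_liftSub_inst (A : Fml S (n + 1)) (f : Fin n → Tm S 0) (u : Tm S 0) :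
    (A.subst (liftSub f)).inst u = A.subst (vecCons u f) := by
  rw [Fml.inst, Fml.subst_subst]
  congr 1
  exact funext <| Fin.cases rfl fun i => ((f i).ren_subst _ _).trans ((f i).subst_closed _)

end Substitution

/-! ### Fresh parameters -/

mutual

theorem Tm.finite_setOf_hasPar : ∀ {n : ℕ} (t : Tm S n), {a | t.HasPar a}.Finite
  | _, .bv _ => by simp [Tm.HasPar]
  | _, .par b => by simp [Tm.HasPar]
  | _, .con _ => by simp [Tm.HasPar]
  | _, .iota F => by simpa only [Tm.HasPar] using Fml.finite_setOf_hasPar F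

theorem Fml.finite_setOf_hasPar : ∀ {n : ℕ} (A : Fml S n), {a | A.HasPar a}.Finite
  | _, .bot => by simp [Fml.HasPar]
  | _, .pred _ ts => by
    simpa only [Fml.HasPar, Set.ofPred_exists] using
      Set.finite_iUnion fun i => Tm.finite_setOf_hasPar (ts i)
  | _, .ex t => by simpa only [Fml.HasPar] using Tm.finite_setOf_hasPar t
  | _, .eq s t => by
    simpa only [Fml.HasPar, Set.ofPred_or] using
      (Tm.finite_setOf_hasPar s).union (Tm.finite_setOf_hasPar t)
  | _, .imp A B => by
    simpa only [Fml.HasPar, Set.ofPred_or] using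
      (Fml.finite_setOf_hasPar A).union (Fml.finite_setOf_hasPar B)
  | _, .all A => by simpa only [Fml.HasPar] using Fml.finite_setOf_hasPar A

end

theorem exists_fresh {Γ : Set (ℕ × Fml S 0)} (hΓ : Γ.Finite) {n : ℕ} (A : Fml S n) :
    ∃ a, (∀ c ∈ Γ, ¬ c.2.HasPar a) ∧ ¬ A.HasPar a := by
  obtain ⟨a, ha⟩ :=
    ((hΓ.biUnion fun c _ => c.2.finite_setOf_hasPar).union A.finite_setOf_hasPar).exists_notMem
  exact ⟨a, fun c hc h => ha (.inl (Set.mem_biUnion hc h)), fun h => ha (.inr h)⟩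

/-! ### Local normality -/

namespace Rule

variable {K n : ℕ} {r r' : Rule S}

/-- Last rules of normal deductions.  The label `K` is reserved for the classes that `botC`
discharges, and assumptions with this label only serve as major premises of `impE`. -/
def IsNf (K : ℕ) (r : Rule S) : Prop := ∀ A, r ≠ .asm K A

/-- Last rules of neutral deductions: eliminations, and assumptions with an unreserved label.  The
label `K + 1` is reserved for the classes that `eqI` discharges. -/
def IsNeu (K : ℕ) (r : Rule S) : Prop := r.IsElim ∨ ∃ i A, r = .asm i A ∧ i ≠ K ∧ i ≠ K + 1

/-- Last rules of the deductions whose conclusion may be the major premise of any elimination except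
`iotaE₃`. -/
def IsMajor (K : ℕ) (r : Rule S) : Prop := r.IsNeu K ∨ r.IsEqE

/-- The requirements of local normality that concern a single rule instance. -/
def LocalOk (K : ℕ) : Rule S → Prop
  | .botC i _ => i = K
  | .eqI i _ _ C => i = K + 1 ∧ C = .bot
  | .eqE A s t => A.inst s ≠ A.inst t ∧ ∀ u, A.inst t ≠ .ex u
  | _ => True

/-- `r.Allows K n r'`: local normality allows premise number `n` of `r` to be concluded by `r'`. -/
def Allows (K : ℕ) : Rule S → ℕ → Rule S → Prop
  | .impE _ _, 0, r' => r'.IsMajor K ∨ ∃ A, r' = .asm K A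
  | .allE _ _, 0, r' => r'.IsMajor K
  | .iotaE₁ _ _ _, 0, r' => r'.IsMajor K
  | .iotaE₂ _ _ _, 0, r' => r'.IsMajor K
  | .iotaE₃ _ _, 0, r' => r'.IsNeu K
  | .ad _ t, 0, r' => r'.IsNeu K ∨ (∃ a s, r' = .asm (K + 1) (.eq (.par a) s) ∧ s ≠ t) ∨
      ∃ i j k a F s, r' = .iotaI i j k a F s
  | .eqI _ _ _ _, 1, r' => r'.IsNf K ∧ r'.concl = .bot
  | _, _, r' => r'.IsNf K

theorem IsNeu.isNf (h : r.IsNeu K) : r.IsNf K := by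
  rintro A rfl
  obtain h | ⟨i, B, h, hK, -⟩ := h
  · exact h
  · cases h
    exact hK rfl

theorem IsMajor.isNf (h : r.IsMajor K) : r.IsNf K := by
  obtain h | h := h
  · exact h.isNf
  · rintro A rfl
    exact h

theorem IsElim.not_isIntro_or_isBotC_or_isEqE (h : r.IsElim) :
    ¬ (r.IsIntro ∨ r.IsBotC ∨ r.IsEqE) := by
  cases r <;> first | exact h.elim | simp [IsIntro, IsBotC, IsEqE]

theorem IsNeu.not_isIntro_or_isBotC_or_isEqE (h : r.IsNeu K) :
    ¬ (r.IsIntro ∨ r.IsBotC ∨ r.IsEqE) := by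
  obtain h | ⟨i, A, rfl, -⟩ := h
  · exact h.not_isIntro_or_isBotC_or_isEqE
  · simp [IsIntro, IsBotC, IsEqE]

theorem IsEqE.not_isIntro_or_isBotC (h : r.IsEqE) : ¬ (r.IsIntro ∨ r.IsBotC) := by
  cases r <;> first | exact h.elim | simp [IsIntro, IsBotC]

theorem IsEqI.isIntro (h : r.IsEqI) : r.IsIntro := by
  cases r <;> first | exact h.elim | trivial

theorem IsMajor.not_isIntro_or_isBotC (h : r.IsMajor K) : ¬ (r.IsIntro ∨ r.IsBotC) := by
  obtain h | h := h
  · exact fun h' => h.not_isIntro_or_isBotC_or_isEqE (h'.imp_right .inl)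
  · exact h.not_isIntro_or_isBotC

theorem Allows.isNf_or (h : r.Allows K n r') : r'.IsNf K ∨ r.IsImpE ∧ n = 0 := by
  cases r <;> rcases n with _ | _ | n
  case impE.zero => exact .inr ⟨trivial, rfl⟩
  case ad.zero =>
    obtain h | ⟨a, s, rfl, -⟩ | ⟨i, j, k, a, F, s, rfl⟩ := h
    · exact .inl h.isNf
    · exact .inl fun A hA => by cases hA
    · exact .inl nofun
  case eqI.succ.zero => exact .inl h.1
  all_goals first | exact .inl h | exact .inl (IsMajor.isNf h) | exact .inl (IsNeu.isNf h)

theorem Allows.not_isIntro_or_isBotC (h : r.Allows K 0 r') (hr : r.IsElim) :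
    ¬ (r'.IsIntro ∨ r'.IsBotC) := by
  have major_or_asm : r'.IsMajor K ∨ ∃ A, r' = .asm K A := by
    cases r <;> first | exact hr.elim | exact h | exact .inl h | exact .inl (.inl h)
  obtain h | ⟨A, rfl⟩ := major_or_asm
  · exact h.not_isIntro_or_isBotC
  · exact not_or_intro id id

theorem Allows.of_isAD (h : r.Allows K 0 r') (hr : r.IsAD) :
    r'.IsNeu K ∨ (∃ a s, r' = .asm (K + 1) (.eq (.par a) s) ∧ r.concl ≠ .ex s) ∨
      ∃ i j k a F s, r' = .iotaI i j k a F s := by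
  cases r <;> try exact hr.elim
  case ad =>
    refine h.imp_right (.imp_left ?_)
    rintro ⟨a, s, h, hs⟩
    exact ⟨a, s, h, fun hst => hs (Fml.ex.inj hst).symm⟩
  case iotaE₃ => exact .inl h

theorem Allows.not_isBotC_or_isEqE_or_isEqI (h : r.Allows K 0 r') (hr : r.IsAD) :
    ¬ (r'.IsBotC ∨ r'.IsEqE ∨ r'.IsEqI) := by
  obtain h | ⟨a, s, rfl, -⟩ | ⟨i, j, k, a, F, s, rfl⟩ := h.of_isAD hr
  · exact fun h' => h.not_isIntro_or_isBotC_or_isEqE <|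
      h'.elim (.inr ∘ .inl) (·.elim (.inr ∘ .inr) (.inl ∘ IsEqI.isIntro))
  all_goals simp [IsBotC, IsEqE, IsEqI]

theorem Allows.concl_ne_ex {a : ℕ} {t : Tm S 0}
    (h : r.Allows K 0 (.asm (K + 1) (.eq (.par a) t))) (hr : r.IsAD) : r.concl ≠ .ex t := by
  obtain h | ⟨b, s, h, hs⟩ | ⟨i, j, k, b, F, s, h⟩ := h.of_isAD hr
  · obtain h | ⟨i, A, h, -, hi⟩ := h
    · exact h.elim
    · cases h
      exact absurd rfl hi
  · cases h
    exact hs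
  · cases h

end Rule

namespace Ded

variable {K n : ℕ} {D : Ded S} {R : Rule S → Prop} {p q : Pos} {r r' : Rule S}

/-- The deduction follows the grammar of normal forms given by `Rule.LocalOk` and `Rule.Allows`,
which implies regularity and normality. -/
def LocallyNormal (K : ℕ) : Ded S → Prop
  | node r ds => r.LocalOk K ∧
      ∀ n : Fin r.prems.length, r.Allows K n (ds n).rule ∧ LocallyNormal K (ds n)

theorem sub_append : ∀ (p q : Pos) (D : Ded S), D.sub (p ++ q) = (D.sub p).bind (·.sub q)
  | [], q, .node _ _ => by simp only [List.nil_append, sub, Option.bind_some]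
  | n :: p, q, .node _ _ => by
    simp only [List.cons_append, sub]
    split
    · exact sub_append p q _
    · rfl

theorem LocallyNormal.sub : ∀ {p : Pos} {D D' : Ded S}, D.LocallyNormal K → D.sub p = some D' →
    D'.LocallyNormal K
  | [], .node _ _, _, hD, h => Option.some.inj h ▸ hD
  | n :: p, .node r ds, D', hD, h => by
    simp only [Ded.sub, Option.dite_none_right_eq_some] at h
    exact (hD.2 _).2.sub h.2

theorem LocallyNormal.localOk (hD : D.LocallyNormal K) (hr : D.ruleAt p = some r) :
    r.LocalOk K := by
  obtain ⟨⟨r, ds⟩, hsub, rfl⟩ := Option.map_eq_some_iff.1 hr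
  exact (hD.sub hsub).1

theorem LocallyNormal.allows (hD : D.LocallyNormal K) (hr : D.ruleAt p = some r)
    (hr' : D.ruleAt (p ++ [n]) = some r') : r.Allows K n r' := by
  obtain ⟨⟨r, ds⟩, hsub, rfl⟩ := Option.map_eq_some_iff.1 hr
  rw [ruleAt, sub_append, hsub, Option.bind_some, Option.map_eq_some_iff] at hr'
  obtain ⟨D', hD', rfl⟩ := hr'
  simp only [Ded.sub, Option.dite_none_right_eq_some] at hD'
  obtain ⟨hn, hD'⟩ := hD'
  cases hds : ds ⟨n, hn⟩ with
  | node r' ds' =>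
    rw [hds] at hD'
    have := ((hD.sub hsub).2 ⟨n, hn⟩).1
    rw [hds] at this
    exact Option.some.inj hD' ▸ this

theorem ConcludedBy.of_ruleAt (h : D.ConcludedBy R p) (hr : D.ruleAt p = some r) : R r := by
  obtain ⟨r', hr', hR⟩ := h
  exact Option.some.inj (hr.symm.trans hr') ▸ hR

theorem PremiseOf.allows (h : D.PremiseOf n R p) (hD : D.LocallyNormal K)
    (hr' : D.ruleAt p = some r') : ∃ r, R r ∧ r.Allows K n r' := by
  obtain ⟨q, rfl, r, hr, hR⟩ := h
  exact ⟨r, hR, hD.allows hr hr'⟩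

theorem exists_ruleAt_of_ruleAt_append (hr : D.ruleAt (q ++ [n]) = some r') :
    ∃ r, D.ruleAt q = some r := by
  obtain ⟨D', hD', -⟩ := Option.map_eq_some_iff.1 hr
  rw [sub_append, Option.bind_eq_some_iff] at hD'
  obtain ⟨D'', hD'', -⟩ := hD'
  exact ⟨D''.rule, by rw [ruleAt, hD'', Option.map_some]⟩

theorem IsSegment.eq_singleton_or_concludedBy {l : List Pos} (hl : D.IsSegment l)
    (hp : l.getLast? = some p) :
    l = [p] ∨ D.ConcludedBy Rule.IsEqI p ∨ D.ConcludedBy Rule.IsBotC p := by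
  obtain ⟨l', rfl⟩ := List.getLast?_eq_some_iff.1 hp
  obtain rfl | ⟨l', q, rfl⟩ := List.eq_nil_or_concat l'
  · exact .inl rfl
  have last_link {L : Pos → Pos → Prop} (h : (l'.concat q ++ [p]).IsChain L) : L q p := by
    simp only [List.concat_eq_append, List.append_assoc, List.isChain_append] at h
    simpa using h.2.1
  obtain ⟨hl, -⟩ | ⟨hl, -⟩ := hl
  · exact .inr (.inl (last_link hl).2)
  · obtain ⟨-, -, -, -, h⟩ := last_link hl
    exact .inr (.inr h)

theorem IsSegment.eq_singleton_of_premiseOf_isAD (hD : D.LocallyNormal K)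
    (hR : ∀ r, R r → r.IsAD) {l : List Pos} (hl : D.IsSegment l) (hp : l.getLast? = some p)
    (hpR : D.PremiseOf 0 R p) : l = [p] := by
  obtain h | ⟨r', hr', h⟩ | ⟨r', hr', h⟩ := hl.eq_singleton_or_concludedBy hp
  · exact h
  all_goals
    obtain ⟨r, hr, hrr'⟩ := hpR.allows hD hr'
    refine absurd ?_ (hrr'.not_isBotC_or_isEqE_or_isEqI (hR r hr))
  · exact .inr (.inr h)
  · exact .inl h

theorem LocallyNormal.label_eq_of_isBotC (hD : D.LocallyNormal K) (hr : D.ruleAt q = some r)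
    (hb : r.IsBotC) {i : ℕ} {A : Fml S 0} (h : (i, A) ∈ r.disch n) : i = K := by
  cases r <;> try exact hb.elim
  have hK := hD.localOk hr
  match n, h with
  | 0, h => exact (Prod.ext_iff.1 h).1.trans hK

theorem LocallyNormal.disch_eqI (hD : D.LocallyNormal K) {i a : ℕ} {t : Tm S 0} {C : Fml S 0}
    (hr : D.ruleAt q = some (.eqI i a t C)) :
    ∀ c ∈ (Rule.eqI i a t C).disch n, c = (K + 1, .eq (.par a) t) := by
  obtain ⟨rfl, -⟩ := hD.localOk hr
  match n with
  | 0 => exact nofun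
  | 1 => exact fun c h => h
  | n + 2 => exact nofun

theorem LocallyNormal.regular (hD : D.LocallyNormal K) : D.Regular := by
  rintro p q ⟨i, A, hp, ⟨n, s, r, rfl, hr, hA⟩, -⟩ hb
  obtain rfl := hD.label_eq_of_isBotC hr (hb.of_ruleAt hr) hA
  obtain ⟨p, m, hpm⟩ : ∃ p m, q ++ n :: s = p ++ [m] := by
    simpa using List.eq_nil_or_concat (q ++ n :: s)
  rw [hpm] at hp ⊢
  obtain ⟨r', hr'⟩ := exists_ruleAt_of_ruleAt_append hp
  obtain ⟨himp, rfl⟩ := (hD.allows hr' hp).isNf_or.resolve_left fun h => h A rfl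
  exact ⟨p, rfl, r', hr', himp⟩

theorem LocallyNormal.not_isMaxIESegment (hD : D.LocallyNormal K) (l : List Pos) :
    ¬ D.IsMaxIESegment l := by
  have no_detour {p : Pos} {r' : Rule S} (hp : D.PremiseOf 0 Rule.IsElim p)
      (hr' : D.ruleAt p = some r') : ¬ (r'.IsIntro ∨ r'.IsBotC) := by
    obtain ⟨r, hr, hrr'⟩ := hp.allows hD hr'
    exact hrr'.not_isIntro_or_isBotC hr
  rintro ⟨hl, p, hp, ⟨helim, hintro⟩ | ⟨⟨r', hr', hb⟩, helim | had⟩⟩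
  · obtain rfl | ⟨r', hr', h⟩ | ⟨r', hr', h⟩ := hl.eq_singleton_or_concludedBy hp
    · obtain ⟨r', hr', h⟩ := hintro rfl
      exact no_detour helim hr' (.inl h)
    · exact no_detour helim hr' (.inl h.isIntro)
    · exact no_detour helim hr' (.inr h)
  · exact no_detour helim hr' (.inr hb)
  · obtain ⟨r, hr, hrr'⟩ := had.allows hD hr'
    exact hrr'.not_isBotC_or_isEqE_or_isEqI hr (.inl hb)

theorem LocallyNormal.not_isMaxEqSegment (hD : D.LocallyNormal K) (l : List Pos) :
    ¬ D.IsMaxEqSegment l := by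
  rintro ⟨hl, ⟨t, htt, ⟨p, hp, hminor⟩, -⟩ |
    ⟨a, t, -, ⟨p, q, hp, ⟨i, A, hasm, ⟨n, s, r, -, hr, hA⟩, -⟩, hq⟩, p', hp', had⟩⟩
  · obtain ⟨r', hr', hconcl⟩ := Option.map_eq_some_iff.1 (htt p hp)
    obtain ⟨r, hr, hrr'⟩ := hminor.allows hD hr'
    cases r <;> try exact hr.elim
    exact absurd (hconcl.symm.trans hrr'.2) nofun
  · obtain rfl := hl.eq_singleton_of_premiseOf_isAD hD (fun r h => h.1) hp' had
    obtain rfl := Option.some.inj hp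
    obtain ⟨j, C, rfl⟩ := hq.of_ruleAt hr
    cases hD.disch_eqI hr _ hA
    obtain ⟨r, ⟨hr, hconcl⟩, hrr'⟩ := had.allows hD hasm
    exact hrr'.concl_ne_ex hr hconcl

theorem LocallyNormal.not_isMaxExSegment (hD : D.LocallyNormal K) (l : List Pos) :
    ¬ D.IsMaxExSegment l := by
  rintro ⟨-, t, -, -, p, -, q, rfl, r, hr, heqI, hconcl⟩
  have hC := hD.localOk hr
  cases r <;> try exact heqI.elim
  exact absurd (hconcl.symm.trans hC.2) nofun

theorem LocallyNormal.not_isMaxEqESegment (hD : D.LocallyNormal K) (L : List (List Pos)) :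
    ¬ D.IsMaxEqESegment L := by
  rintro ⟨⟨hL, -, -, l, hl, ⟨p, hp, r', hr', heqE⟩, -⟩, ⟨l', p', hl', hp', had⟩ | hex⟩
  · obtain rfl := Option.some.inj (hl.symm.trans hl')
    obtain rfl := (hL l (List.mem_of_getLast? hl)).eq_singleton_of_premiseOf_isAD hD
      (fun r h => h) hp' had
    obtain rfl := Option.some.inj hp
    obtain ⟨r, hr, hrr'⟩ := had.allows hD hr'
    exact hrr'.not_isBotC_or_isEqE_or_isEqI hr (.inr (.inl heqE))
  · obtain ⟨t, ht⟩ := hex l (List.mem_of_getLast? hl) p (List.mem_of_head? hp)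
    obtain ⟨r, hr, hconcl⟩ := Option.map_eq_some_iff.1 ht
    have hok := hD.localOk hr
    obtain rfl := Option.some.inj (hr.symm.trans hr')
    cases r <;> try exact heqE.elim
    exact hok.2 t hconcl

theorem LocallyNormal.not_concludedBy_isVacuousEqE (hD : D.LocallyNormal K) (p : Pos) :
    ¬ D.ConcludedBy Rule.IsVacuousEqE p := by
  rintro ⟨r, hr, hvac⟩
  have hok := hD.localOk hr
  cases r <;> try exact hvac.elim
  exact hok.1 hvac

theorem LocallyNormal.normal (hD : D.LocallyNormal K) : D.Normal :=
  ⟨hD.not_isMaxIESegment, hD.not_isMaxEqSegment, hD.not_isMaxExSegment, hD.not_isMaxEqESegment,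
    hD.not_concludedBy_isVacuousEqE⟩

end Ded

/-! ### Derivability by locally normal deductions -/

section Derivability

/-- `A` has a correct and locally normal deduction whose last rule satisfies `R` and whose open
assumption classes lie between `Δ` and `Γ`.  The lower bound `Δ` serves to show that an application
of `botC` does discharge something. -/
def Der (K : ℕ) (R : Rule S → Prop) (Δ Γ : Set (ℕ × Fml S 0)) (A : Fml S 0) : Prop :=
  ∃ D : Ded S, D.Correct ∧ D.LocallyNormal K ∧ D.concl = A ∧ R D.rule ∧
    Δ ⊆ D.openAsm ∧ D.openAsm ⊆ Γ

/-- Derivability by normal deductions. -/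
abbrev Nf (K : ℕ) (Γ : Set (ℕ × Fml S 0)) (A : Fml S 0) : Prop := Der K (Rule.IsNf K) ∅ Γ A

/-- Derivability by neutral deductions. -/
abbrev Neu (K : ℕ) (Γ : Set (ℕ × Fml S 0)) (A : Fml S 0) : Prop := Der K (Rule.IsNeu K) ∅ Γ A

/-- Derivability by deductions whose conclusion may be the major premise of an elimination. -/
abbrev Major (K : ℕ) (Γ : Set (ℕ × Fml S 0)) (A : Fml S 0) : Prop := Der K (Rule.IsMajor K) ∅ Γ A

variable {K : ℕ} {Δ Δ' Γ Γ' : Set (ℕ × Fml S 0)} {A B : Fml S 0} {s t u : Tm S 0}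
  {R R' : Rule S → Prop} {r : Rule S}

theorem Der.imp (h : Der K R Δ Γ A) (hR : ∀ r, R r → R' r) (hΔ : Δ' ⊆ Δ) (hΓ : Γ ⊆ Γ') :
    Der K R' Δ' Γ' A :=
  let ⟨D, hD, hloc, hA, hr, hl, hu⟩ := h
  ⟨D, hD, hloc, hA, hR _ hr, hΔ.trans hl, hu.trans hΓ⟩

theorem Der.mono (h : Der K R Δ Γ A) (hΓ : Γ ⊆ Γ') : Der K R Δ Γ' A :=
  h.imp (fun _ => id) subset_rfl hΓ

theorem Der.imp_rule (h : Der K R Δ Γ A) (hR : ∀ r, R r → R' r) : Der K R' Δ Γ A :=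
  h.imp hR subset_rfl subset_rfl

theorem Der.imp_rule_concl (h : Der K R Δ Γ A) (hR : ∀ r, r.concl = A → R r → R' r) :
    Der K R' Δ Γ A :=
  let ⟨D, hD, hloc, hA, hr, hl, hu⟩ := h
  ⟨D, hD, hloc, hA, hR _ hA hr, hl, hu⟩

theorem Neu.nf (h : Neu K Γ A) : Nf K Γ A := h.imp_rule fun _ => Rule.IsNeu.isNf

theorem Neu.major (h : Neu K Γ A) : Major K Γ A := h.imp_rule fun _ => .inl

theorem Major.nf (h : Major K Γ A) : Nf K Γ A := h.imp_rule fun _ => Rule.IsMajor.isNf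

theorem Der.node {Δ : Fin r.prems.length → Set (ℕ × Fml S 0)} (hok : r.Ok) (hloc : r.LocalOk K)
    (hasm : ∀ c : ℕ × Fml S 0, r = .asm c.1 c.2 → c ∈ Γ)
    (heigen : ∀ (n : Fin r.prems.length) a, r.eigen n = some a → ∀ c ∈ Γ, ¬ c.2.HasPar a)
    (hbotC : ∀ i A, r = .botC i A → A.IsPrime ∨ ∃ n, (i, A.neg) ∈ Δ n)
    (hprem : ∀ n : Fin r.prems.length,
      Der K (r.Allows K n) (Δ n) (r.disch n ∪ Γ) (r.prems.get n)) :
    Der K (· = r) ({c | r = .asm c.1 c.2} ∪ ⋃ n, (Δ n \ r.disch n)) Γ r.concl := by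
  choose ds hcor hnormal hconcl hallows hlower hupper using hprem
  refine ⟨.node r ds, ⟨hcor, hconcl, hok, ?_, ?_⟩, ⟨hloc, fun n => ⟨hallows n, hnormal n⟩⟩,
    rfl, rfl, ?_, ?_⟩
  · exact fun n a ha c hc hdisch => heigen n a ha c ((hupper n hc).resolve_left hdisch)
  · exact fun i A hr => (hbotC i A hr).imp_right fun ⟨n, hn⟩ => ⟨n, hlower n hn⟩
  · exact Set.union_subset_union_right _
      (Set.iUnion_mono fun n => Set.sdiff_subset_sdiff_left (hlower n))
  · exact Set.union_subset hasm (Set.iUnion_subset fun n c hc => (hupper n hc.1).resolve_left hc.2)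

theorem Der.of_prems (hok : r.Ok) (hloc : r.LocalOk K) (hasm : ∀ i A, r ≠ .asm i A)
    (hbotC : ¬ r.IsBotC)
    (heigen : ∀ (n : Fin r.prems.length) a, r.eigen n = some a → ∀ c ∈ Γ, ¬ c.2.HasPar a)
    (hprem : ∀ n : Fin r.prems.length,
      Der K (r.Allows K n) ∅ (r.disch n ∪ Γ) (r.prems.get n)) :
    Der K (· = r) ∅ Γ r.concl :=
  (Der.node (Δ := fun _ => ∅) hok hloc (fun _ h => absurd h (hasm _ _)) heigen
    (fun _ _ h => (hbotC (h ▸ trivial)).elim) hprem).imp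
    (fun _ => id) (Set.empty_subset _) subset_rfl

theorem Der.asm {i : ℕ} (h : (i, A) ∈ Γ) : Der K (· = .asm i A) {(i, A)} Γ A :=
  (Der.node (r := .asm i A) (Δ := Fin.elim0) trivial trivial (by rintro c ⟨⟩; exact h) nofun nofun
    (fun n => n.elim0)).imp (fun _ => id) (by rintro c rfl; exact .inl rfl) subset_rfl

theorem Neu.asm {i : ℕ} (h : (i, A) ∈ Γ) (hK : i ≠ K) (hK' : i ≠ K + 1) : Neu K Γ A :=
  (Der.asm h).imp (fun _ hr => .inr ⟨i, A, hr, hK, hK'⟩) (Set.empty_subset _) subset_rfl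

theorem Nf.asm {i : ℕ} (h : (i, A) ∈ Γ) (hK : i ≠ K) : Nf K Γ A :=
  (Der.asm h).imp (by rintro _ rfl B ⟨⟩; exact hK rfl) (Set.empty_subset _) subset_rfl

theorem Neu.elim (hr : r.IsElim) (hok : r.Ok)
    (hprem : ∀ n : Fin r.prems.length, Der K (r.Allows K n) ∅ Γ (r.prems.get n)) :
    Neu K Γ r.concl := by
  refine (Der.of_prems hok ?_ ?_ ?_ ?_ fun n => (hprem n).mono
    Set.subset_union_right).imp_rule fun r' h => .inl (h ▸ hr)
  all_goals cases r <;> first | exact hr.elim | exact trivial | exact id | exact nofun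

theorem Neu.impE (hAB : Major K Γ (.imp A B)) (hA : Nf K Γ A) : Neu K Γ B :=
  Neu.elim (r := .impE A B) trivial trivial <|
    Fin.forall_fin_two.2 ⟨hAB.imp_rule fun _ => .inl, hA⟩

theorem Neu.allE {A : Fml S 1} (ht : t.IsAtomic) (hA : Major K Γ (.all A)) (hex : Nf K Γ (.ex t)) :
    Neu K Γ (A.inst t) :=
  Neu.elim (r := .allE A t) trivial ht <| Fin.forall_fin_two.2 ⟨hA, hex⟩

theorem Neu.iotaE₁ {F : Fml S 1} (ht : t.IsAtomic) (hu : u.IsAtomic)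
    (hF : Major K Γ (.eq (.iota F) t)) (hut : Nf K Γ (.eq u t)) : Neu K Γ (F.inst u) :=
  Neu.elim (r := .iotaE₁ F t u) trivial ⟨ht, hu⟩ <| Fin.forall_fin_two.2 ⟨hF, hut⟩

theorem Neu.iotaE₂ {F : Fml S 1} (ht : t.IsAtomic) (hu : u.IsAtomic)
    (hF : Major K Γ (.eq (.iota F) t)) (hFu : Nf K Γ (F.inst u)) (hex : Nf K Γ (.ex u)) :
    Neu K Γ (.eq u t) :=
  Neu.elim (r := .iotaE₂ F t u) trivial ⟨ht, hu⟩ <|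
    Fin.forall_fin_succ.2 ⟨hF, Fin.forall_fin_two.2 ⟨hFu, hex⟩⟩

theorem Neu.iotaE₃ {F : Fml S 1} (hF : Neu K Γ (.eq (.iota F) t)) : Neu K Γ (.ex t) :=
  Neu.elim (r := .iotaE₃ F t) trivial trivial <| Fin.forall_fin_one.2 hF

theorem Nf.impI {i : ℕ} (h : Nf K (insert (i, A) Γ) B) : Nf K Γ (.imp A B) :=
  (Der.of_prems (r := .impI i A B) trivial trivial nofun id nofun
    (Fin.forall_fin_one.2 h)).imp_rule fun _ hr => hr ▸ nofun

theorem Nf.allI {i a : ℕ} {A : Fml S 1} (hA : ¬ A.HasPar a) (hΓ : ∀ c ∈ Γ, ¬ c.2.HasPar a)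
    (h : Nf K (insert (i, .ex (.par a)) Γ) (A.inst (.par a))) : Nf K Γ (.all A) :=
  (Der.of_prems (r := .allI i a A) hA trivial nofun id (by rintro _ _ ⟨⟩; exact hΓ)
    (Fin.forall_fin_one.2 h)).imp_rule fun _ hr => hr ▸ nofun

theorem Der.iotaI {i j k a : ℕ} {F : Fml S 1} (ht : t.IsAtomic) (hF : ¬ F.HasPar a)
    (hta : ¬ t.HasPar a) (hΓ : ∀ c ∈ Γ, ¬ c.2.HasPar a) (hex : Nf K Γ (.ex t))
    (hFa : Nf K (insert (i, .eq (.par a) t) Γ) (F.inst (.par a)))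
    (hat : Nf K (insert (j, F.inst (.par a)) (insert (k, .ex (.par a)) Γ)) (.eq (.par a) t)) :
    Der K (· = .iotaI i j k a F t) ∅ Γ (.eq (.iota F) t) := by
  refine Der.of_prems (r := .iotaI i j k a F t) ⟨ht, hF, hta⟩ trivial nofun id
    (by rintro _ _ ⟨⟩; exact hΓ) (Fin.forall_fin_succ.2 ⟨?_, Fin.forall_fin_two.2 ⟨hFa, ?_⟩⟩)
  · exact hex.mono Set.subset_union_right
  · exact hat.mono (Set.insert_union (s := {_}) ▸ subset_rfl)

theorem Der.eqI {a : ℕ} (ht : ¬ t.HasPar a) (hΓ : ∀ c ∈ Γ, ¬ c.2.HasPar a) (hex : Nf K Γ (.ex t))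
    (h : Der K (Rule.IsNf K) Δ (insert (K + 1, .eq (.par a) t) Γ) .bot) :
    Der K (Rule.IsNf K) (Δ \ {(K + 1, .eq (.par a) t)}) Γ .bot := by
  refine (Der.node (r := .eqI (K + 1) a t .bot) (Δ := ![∅, Δ]) ⟨ht, id⟩ ⟨rfl, rfl⟩ nofun ?_ nofun
    (Fin.forall_fin_two.2 ⟨?_, ?_⟩)).imp (fun _ hr => hr ▸ nofun) ?_ subset_rfl
  · exact Fin.forall_fin_two.2 ⟨nofun, by rintro _ ⟨⟩; exact hΓ⟩
  · exact hex.mono Set.subset_union_right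
  · exact h.imp_rule_concl fun _ hbot hr => ⟨hr, hbot⟩
  · exact fun c hc => .inr (Set.mem_iUnion.2 ⟨⟨1, Nat.one_lt_two⟩, hc⟩)

theorem Nf.eqI {a : ℕ} (ht : ¬ t.HasPar a) (hΓ : ∀ c ∈ Γ, ¬ c.2.HasPar a) (hex : Nf K Γ (.ex t))
    (h : Nf K (insert (K + 1, .eq (.par a) t) Γ) .bot) : Nf K Γ .bot :=
  (Der.eqI ht hΓ hex h).imp (fun _ => id) (Set.empty_subset _) subset_rfl

theorem Major.eqE {A : Fml S 1} (hA : A.IsAtomic) (hne : A.inst s ≠ A.inst t)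
    (hex : ∀ u, A.inst t ≠ .ex u) (hst : Nf K Γ (.eq s t)) (hs : Nf K Γ (A.inst s)) :
    Major K Γ (A.inst t) :=
  (Der.of_prems (r := .eqE A s t) hA ⟨hne, hex⟩ nofun id nofun <| Fin.forall_fin_two.2
    ⟨hst.mono Set.subset_union_right, hs.mono Set.subset_union_right⟩).imp_rule
    fun _ hr => .inr (hr ▸ trivial)

theorem Nf.eqE {A : Fml S 1} (hA : A.IsAtomic) (hex : ∀ u, A.inst t ≠ .ex u)
    (hst : Nf K Γ (.eq s t)) (hs : Nf K Γ (A.inst s)) : Nf K Γ (A.inst t) := by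
  by_cases hne : A.inst s = A.inst t
  · rwa [← hne]
  · exact (Major.eqE hA hne hex hst hs).nf

theorem Nf.ad (hA : A.HasArg t) (hF : ∀ F, A ≠ .eq (.iota F) t)
    (h : Der K (Rule.Allows K (.ad A t) 0) ∅ Γ A) : Nf K Γ (.ex t) :=
  (Der.of_prems (r := .ad A t) ⟨hA, hF⟩ trivial nofun id nofun
    (Fin.forall_fin_one.2 (h.mono Set.subset_union_right))).imp_rule fun _ hr => hr ▸ nofun

theorem Neu.ad (hA : A.HasArg t) (h : Neu K Γ A) : Nf K Γ (.ex t) := by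
  by_cases hF : ∃ F, A = .eq (.iota F) t
  · obtain ⟨F, rfl⟩ := hF
    exact h.iotaE₃.nf
  · exact Nf.ad hA (not_exists.1 hF) (h.imp_rule fun _ => .inl)

theorem Neu.ex_left (h : Neu K Γ (.eq s t)) : Nf K Γ (.ex s) := Neu.ad (A := .eq s t) (.inl rfl) h

theorem Neu.ex_right (h : Neu K Γ (.eq s t)) : Nf K Γ (.ex t) := Neu.ad (A := .eq s t) (.inr rfl) h

/-- `a` is available in `Γ` as a name of `t`: the label `K + 1` of the assumption `a = t` is the one
reserved for discharge by `eqI`. -/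
def IsName (K : ℕ) (Γ : Set (ℕ × Fml S 0)) (a : ℕ) (t : Tm S 0) : Prop :=
  (K + 1, .eq (.par a) t) ∈ Γ ∧ ¬ t.HasPar a

theorem IsName.nf_eq {a : ℕ} (ha : IsName K Γ a t) : Nf K Γ (.eq (.par a) t) :=
  Nf.asm ha.1 K.succ_ne_self

theorem IsName.nf_ex {a : ℕ} (ha : IsName K Γ a t) : Nf K Γ (.ex (.par a)) :=
  Nf.ad (A := .eq (.par a) t) (.inl rfl) nofun <| (Der.asm ha.1).imp
    (fun _ hr => .inr (.inl ⟨a, t, hr, fun hta => ha.2 (hta ▸ rfl)⟩)) (Set.empty_subset _)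
    subset_rfl

theorem Nf.ex_iota {i j k a : ℕ} {F : Fml S 1} (ht : t.IsAtomic)
    (h : Der K (· = .iotaI i j k a F t) ∅ Γ (.eq (.iota F) t)) : Nf K Γ (.ex (.iota F)) :=
  Nf.ad (A := .eq (.iota F) t) (.inl rfl) (by rintro _ ⟨⟩; exact ht)
    (h.imp_rule fun _ hr => .inr (.inr ⟨i, j, k, a, F, t, hr⟩))

/-! ### Reductio and identity in normal deductions -/

theorem Der.refute (hA : (K, A.neg) ∈ Γ) (h : Nf K Γ A) :
    Der K (Rule.IsNf K) {(K, A.neg)} Γ .bot := by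
  refine (Der.node (r := .impE A .bot) (Δ := ![{(K, A.neg)}, ∅]) trivial trivial nofun nofun nofun
    (Fin.forall_fin_two.2 ⟨?_, ?_⟩)).imp (fun _ hr => hr ▸ nofun) ?_ subset_rfl
  · exact (Der.asm (.inr hA)).imp_rule fun _ hr => .inr ⟨A.neg, hr⟩
  · exact h.mono Set.subset_union_right
  · exact fun c hc => .inr (Set.mem_iUnion.2 ⟨⟨0, Nat.two_pos⟩, hc, id⟩)

theorem Nf.refute (hA : (K, A.neg) ∈ Γ) (h : Nf K Γ A) : Nf K Γ .bot :=
  (Der.refute hA h).imp (fun _ => id) (Set.empty_subset _) subset_rfl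

theorem Nf.botC (hA : A.IsAtomic) (hΔ : A.IsPrime ∨ (K, A.neg) ∈ Δ)
    (h : Der K (Rule.IsNf K) Δ (insert (K, A.neg) Γ) .bot) : Nf K Γ A :=
  (Der.node (r := .botC K A) (Δ := fun _ => Δ) hA rfl nofun nofun
    (by rintro _ _ ⟨⟩; exact hΔ.imp_right fun h => ⟨⟨0, Nat.one_pos⟩, h⟩)
    (Fin.forall_fin_one.2 h)).imp (fun _ hr => hr ▸ nofun) (Set.empty_subset _) subset_rfl

theorem Fml.IsPrime.isAtomic (h : A.IsPrime) : A.IsAtomic := by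
  cases A <;> first | exact h.elim | trivial

theorem Nf.exfalso_prime (hA : A.IsPrime) (h : Nf K Γ .bot) : Nf K Γ A :=
  Nf.botC hA.isAtomic (.inl hA) (h.mono (Set.subset_insert _ _))

theorem Nf.reductio (hA : A.IsAtomic) (h : Nf K (insert (K, A.neg) Γ) .bot)
    (hbot : Nf K Γ .bot → Nf K Γ A) : Nf K Γ A := by
  obtain ⟨D, hD, hloc, hconcl, hr, hlower, hupper⟩ := h
  by_cases hused : (K, A.neg) ∈ D.openAsm
  · exact Nf.botC hA (.inr hused) ⟨D, hD, hloc, hconcl, hr, subset_rfl, hupper⟩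
  · have hΓ : D.openAsm ⊆ Γ := (Set.subset_insert_iff_of_notMem hused).1 hupper
    exact hbot ⟨D, hD, hloc, hconcl, hr, hlower, hΓ⟩

theorem Nf.eq_replace_left (hst : Nf K Γ (.eq s t)) (hsu : Nf K Γ (.eq s u)) :
    Nf K Γ (.eq t u) := by
  have inst_eq (w : Tm S 0) : (Fml.eq (.bv 0) u.wk).inst w = .eq w u := by
    simp only [Fml.inst, Fml.subst, Tm.subst, Tm.wk_subst]
  rw [← inst_eq] at hsu ⊢
  exact Nf.eqE trivial (fun _ => nofun) hst hsu

theorem Nf.eq_replace_right (hst : Nf K Γ (.eq s t)) (hus : Nf K Γ (.eq u s)) :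
    Nf K Γ (.eq u t) := by
  have inst_eq (w : Tm S 0) : (Fml.eq u.wk (.bv 0)).inst w = .eq u w := by
    simp only [Fml.inst, Fml.subst, Tm.subst, Tm.wk_subst]
  rw [← inst_eq] at hus ⊢
  exact Nf.eqE trivial (fun _ => nofun) hst hus

/-- With a name `a` for `t`, two uses of `a = t` yield `t = t`; since `eqI` is to conclude `⊥`, this
is turned into a refutation of `¬ t = t`. -/
theorem Nf.refl (hΓ : Γ.Finite) (ht : Nf K Γ (.ex t)) : Nf K Γ (.eq t t) := by
  obtain ⟨a, haΓ, hat⟩ := exists_fresh hΓ (Fml.eq t t)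
  set Γ' := insert (K, (Fml.eq t t).neg) Γ
  have haΓ' : ∀ c ∈ Γ', ¬ c.2.HasPar a :=
    Set.forall_mem_insert.2 ⟨fun h => h.elim hat id, haΓ⟩
  have name : Nf K (insert (K + 1, .eq (.par a) t) Γ') (.eq (.par a) t) :=
    Nf.asm (Set.mem_insert _ _) K.succ_ne_self
  have refutation := Der.eqI (fun h => hat (.inl h)) haΓ' (ht.mono (Set.subset_insert _ _))
    (Der.refute (Set.mem_insert_of_mem _ (Set.mem_insert _ _)) (name.eq_replace_left name))
  have hne : (K, (Fml.eq t t).neg) ≠ (K + 1, .eq (.par a) t) :=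
    fun h => K.succ_ne_self (Prod.ext_iff.1 h).1.symm
  exact Nf.botC trivial (.inr (Set.mem_sdiff_singleton.2 ⟨Set.mem_singleton _, hne⟩)) refutation

theorem Nf.symm (hΓ : Γ.Finite) (hst : Nf K Γ (.eq s t)) (hs : Nf K Γ (.ex s)) :
    Nf K Γ (.eq t s) :=
  hst.eq_replace_left (hs.refl hΓ)

section Predicates

variable {P : S.Pred} {w w' : Fin (S.ar P) → Tm S 0}

theorem Nf.pred_update [DecidableEq (Fin (S.ar P))] {i : Fin (S.ar P)} (hst : Nf K Γ (.eq s t))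
    (h : Nf K Γ (.pred P (Function.update w i s))) :
    Nf K Γ (.pred P (Function.update w i t)) := by
  have inst_eq (x : Tm S 0) : (Fml.pred P (Function.update (fun j => (w j).wk) i (.bv 0))).inst x =
      .pred P (Function.update w i x) := by
    simp only [Fml.inst, Fml.subst]
    congr 1
    funext j
    obtain rfl | hj := eq_or_ne j i
    · simp only [Function.update_self, Tm.subst]
    · simp only [Function.update_of_ne hj, Tm.wk_subst]
  rw [← inst_eq] at h ⊢
  exact Nf.eqE trivial (fun _ => nofun) hst h

theorem Nf.pred_replace (hw : ∀ i, Nf K Γ (.eq (w i) (w' i))) (h : Nf K Γ (.pred P w)) :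
    Nf K Γ (.pred P w') := by
  suffices ∀ T : Finset (Fin (S.ar P)), Nf K Γ (.pred P (T.piecewise w' w)) by
    simpa only [Finset.piecewise_univ] using this Finset.univ
  intro T
  induction T using Finset.induction_on with
  | empty => simpa only [Finset.piecewise_empty] using h
  | insert i T hi ih =>
    rw [← Function.update_eq_self i (T.piecewise w' w),
      Finset.piecewise_eq_of_notMem _ _ _ hi] at ih
    rw [Finset.piecewise_insert]
    exact Nf.pred_update (hw i) ih

end Predicates

end Derivability

/-! ### Forcing -/

section Forcing

/-- Finite sets of assumption classes, ordered by inclusion: the worlds of the model. -/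
abbrev World (S : Sig.{u, v}) := {Γ : Set (ℕ × Fml S 0) // Γ.Finite}

/-- Extension of a world by an assumption class. -/
def World.ins (c : ℕ × Fml S 0) (Γ : World S) : World S := ⟨insert c Γ.1, Γ.2.insert c⟩

theorem World.le_ins (c : ℕ × Fml S 0) (Γ : World S) : Γ ≤ Γ.ins c := Set.subset_insert _ _

theorem World.mem_ins (c : ℕ × Fml S 0) (Γ : World S) : c ∈ (Γ.ins c).1 := Set.mem_insert _ _

/-- The atomic terms of the language: the objects of the model, up to derivable identity. -/
abbrev Atom (S : Sig.{u, v}) := {t : Tm S 0 // t.IsAtomic}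

/-- The atomic term given by a parameter. -/
def Atom.par (a : ℕ) : Atom S := ⟨.par a, trivial⟩

/-- Identity of existing atomic terms. -/
def EqAt (K : ℕ) (Γ : World S) (s t : Atom S) : Prop :=
  Nf K Γ.1 (.eq s.1 t.1) ∧ Nf K Γ.1 (.ex s.1) ∧ Nf K Γ.1 (.ex t.1)

/-- Double negation of a condition on worlds, where absurdity is derivability of `⊥`. -/
def NotNot (K : ℕ) (P : World S → Prop) (Γ : World S) : Prop :=
  ∀ Γ' ≥ Γ, (∀ Γ'' ≥ Γ', P Γ'' → Nf K Γ''.1 .bot) → Nf K Γ'.1 .bot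

/-- Values of terms: `v Γ c` says that, at `Γ`, the term denotes the same object as `c`. -/
abbrev Val (S : Sig.{u, v}) := World S → Atom S → Prop

/-- The value of an atomic term. -/
def Atom.val (K : ℕ) (c : Atom S) : Val S := fun Γ d => EqAt K Γ c d

/-- The value of a description: it denotes `c` when `c` exists and is, from then on, the only
existing object with the property `Φ`. -/
def Val.desc (K : ℕ) (Φ : Atom S → World S → Prop) : Val S := fun Γ c =>
  Nf K Γ.1 (.ex c.1) ∧ ∀ Γ' ≥ Γ, ∀ u : Atom S,
    (EqAt K Γ' u c → Φ u Γ') ∧ (Φ u Γ' → Nf K Γ'.1 (.ex u.1) → EqAt K Γ' u c)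

mutual
/-- The value of a term, for values `η` of the parameters and `ρ` of the loose variables. -/
def Tm.den (K : ℕ) (η : ℕ → Val S) : {n : ℕ} → Tm S n → (Fin n → Val S) → Val S
  | _, .bv k, ρ => ρ k
  | _, .par a, _ => η a
  | _, .con c, _ => Atom.val K ⟨.con c, trivial⟩
  | _, .iota F, ρ => Val.desc K fun u => F.force K η (vecCons (u.val K) ρ)
/-- The worlds that force a formula, for values `η` of the parameters and `ρ` of the loose
variables. -/
def Fml.force (K : ℕ) (η : ℕ → Val S) : {n : ℕ} → Fml S n → (Fin n → Val S) → World S → Prop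
  | _, .bot, _ => fun Γ => Nf K Γ.1 .bot
  | _, .pred R ts, ρ => NotNot K fun Γ => ∃ c : Fin (S.ar R) → Atom S,
      (∀ k, (ts k).den K η ρ Γ (c k)) ∧ Nf K Γ.1 (.pred R fun k => (c k).1)
  | _, .ex t, ρ => NotNot K fun Γ => ∃ c, t.den K η ρ Γ c
  | _, .eq s t, ρ => NotNot K fun Γ => ∃ c, s.den K η ρ Γ c ∧ t.den K η ρ Γ c
  | _, .imp A B, ρ => fun Γ => ∀ Γ' ≥ Γ, A.force K η ρ Γ' → B.force K η ρ Γ'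
  | _, .all A, ρ => fun Γ => ∀ Γ' ≥ Γ, ∀ u : Atom S, Nf K Γ'.1 (.ex u.1) →
      A.force K η (vecCons (u.val K) ρ) Γ'
end

variable {K : ℕ} {η η' : ℕ → Val S} {Γ Γ' : World S} {P Q : World S → Prop}

namespace NotNot

theorem mono (h : NotNot K P Γ) (hΓ : Γ ≤ Γ') : NotNot K P Γ' :=
  fun _ hΓ' => h _ (hΓ.trans hΓ')

theorem intro (h : ∀ Γ' ≥ Γ, P Γ') : NotNot K P Γ := fun _ hΓ hP => hP _ le_rfl (h _ hΓ)

theorem bind (h : NotNot K P Γ) (hPQ : ∀ Γ' ≥ Γ, P Γ' → NotNot K Q Γ') : NotNot K Q Γ :=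
  fun _ h₁ hQ => h _ h₁ fun _ h₂ hP =>
    hPQ _ (h₁.trans h₂) hP _ le_rfl fun _ h₃ => hQ _ (h₂.trans h₃)

theorem imp (h : NotNot K P Γ) (hPQ : ∀ Γ' ≥ Γ, P Γ' → Q Γ') : NotNot K Q Γ :=
  fun _ h₁ hQ => h _ h₁ fun _ h₂ hP => hQ _ h₂ (hPQ _ (h₁.trans h₂) hP)

theorem of_bot (h : Nf K Γ.1 .bot) : NotNot K P Γ := fun _ hΓ _ => h.mono hΓ

theorem congr (h : ∀ Γ' ≥ Γ, (P Γ' ↔ Q Γ')) : NotNot K P Γ ↔ NotNot K Q Γ :=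
  ⟨(imp · fun _ hΓ => (h _ hΓ).1), (imp · fun _ hΓ => (h _ hΓ).2)⟩

theorem nf {A : Fml S 0} (hA : A.IsAtomic) (hbot : Nf K Γ.1 .bot → P Γ)
    (hP : ∀ Γ' ≥ Γ, P Γ' → Nf K Γ'.1 A) (h : NotNot K P Γ) : Nf K Γ.1 A :=
  Nf.reductio hA
    (h (Γ.ins (K, A.neg)) (World.le_ins _ _) fun _ hΓ' hPΓ' =>
      Nf.refute (hΓ' (World.mem_ins _ _)) (hP _ ((World.le_ins _ _).trans hΓ') hPΓ'))
    fun h => hP Γ le_rfl (hbot h)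

theorem nf_prime {A : Fml S 0} (hA : A.IsPrime) (h : NotNot K (fun Γ => Nf K Γ.1 A) Γ) :
    Nf K Γ.1 A :=
  h.nf hA.isAtomic (Nf.exfalso_prime hA) fun _ _ => id

end NotNot

namespace EqAt

variable {c d e : Atom S}

theorem mono (h : EqAt K Γ c d) (hΓ : Γ ≤ Γ') : EqAt K Γ' c d :=
  ⟨h.1.mono hΓ, h.2.1.mono hΓ, h.2.2.mono hΓ⟩

theorem refl (h : Nf K Γ.1 (.ex c.1)) : EqAt K Γ c c := ⟨h.refl Γ.2, h, h⟩

theorem symm (h : EqAt K Γ c d) : EqAt K Γ d c := ⟨h.1.symm Γ.2 h.2.1, h.2.2, h.2.1⟩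

theorem trans (h : EqAt K Γ c d) (h' : EqAt K Γ d e) : EqAt K Γ c e :=
  ⟨h'.1.eq_replace_right h.1, h.2.1, h'.2.2⟩

theorem of_notNot (h : NotNot K (fun Γ => EqAt K Γ c d) Γ) : EqAt K Γ c d :=
  ⟨NotNot.nf_prime ⟨c.2, d.2⟩ (h.imp fun _ _ h => h.1),
    NotNot.nf_prime c.2 (h.imp fun _ _ h => h.2.1), NotNot.nf_prime d.2 (h.imp fun _ _ h => h.2.2)⟩

theorem of_bot (h : Nf K Γ.1 .bot) : EqAt K Γ c d := of_notNot (.of_bot h)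

end EqAt

theorem Fml.force_mono : ∀ {n : ℕ} (A : Fml S n) {ρ : Fin n → Val S} {Γ Γ' : World S},
    A.force K η ρ Γ → Γ ≤ Γ' → A.force K η ρ Γ'
  | _, .bot, _, _, _, h, hΓ => Der.mono h hΓ
  | _, .pred _ _, _, _, _, h, hΓ => NotNot.mono h hΓ
  | _, .ex _, _, _, _, h, hΓ => NotNot.mono h hΓ
  | _, .eq _ _, _, _, _, h, hΓ => NotNot.mono h hΓ
  | _, .imp _ _, _, _, _, h, hΓ => fun _ hΓ' => h _ (hΓ.trans hΓ')
  | _, .all _, _, _, _, h, hΓ => fun _ hΓ' => h _ (hΓ.trans hΓ')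

theorem Fml.force_of_notNot : ∀ {n : ℕ} (A : Fml S n) {ρ : Fin n → Val S} {Γ : World S},
    NotNot K (A.force K η ρ) Γ → A.force K η ρ Γ
  | _, .bot, _, _, h => h _ le_rfl fun _ _ => id
  | _, .pred _ _, _, _, h => h.bind fun _ _ => id
  | _, .ex _, _, _, h => h.bind fun _ _ => id
  | _, .eq _ _, _, _, h => h.bind fun _ _ => id
  | _, .imp A B, _, _, h => fun _ hΓ hA => B.force_of_notNot
      ((h.mono hΓ).imp fun _ hΓ' hAB => hAB _ le_rfl (A.force_mono hA hΓ'))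
  | _, .all A, _, _, h => fun _ hΓ _ hu => A.force_of_notNot
      ((h.mono hΓ).imp fun _ hΓ' hA => hA _ le_rfl _ (hu.mono hΓ'))

theorem Fml.force_bind {n : ℕ} {A : Fml S n} {ρ : Fin n → Val S} (h : NotNot K P Γ)
    (hP : ∀ Γ' ≥ Γ, P Γ' → A.force K η ρ Γ') : A.force K η ρ Γ :=
  A.force_of_notNot (h.imp hP)

theorem Fml.force_of_bot {n : ℕ} {A : Fml S n} {ρ : Fin n → Val S} (h : Nf K Γ.1 .bot) :
    A.force K η ρ Γ :=
  A.force_of_notNot (.of_bot h)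

/-! ### Dependence on the values of parameters and variables -/

/-- Agreement of values from a world on. -/
def Val.Agree (Γ : World S) (v w : Val S) : Prop := ∀ Γ' ≥ Γ, ∀ c, v Γ' c ↔ w Γ' c

theorem Val.Agree.rfl {v : Val S} : v.Agree Γ v := fun _ _ _ => Iff.rfl

theorem Val.Agree.vecCons {n : ℕ} {v : Val S} {ρ ρ' : Fin n → Val S}
    (h : ∀ k, (ρ k).Agree Γ (ρ' k)) (k : Fin (n + 1)) :
    (vecCons v ρ k).Agree Γ (Matrix.vecCons v ρ' k) :=
  Fin.cases (motive := fun k => (Matrix.vecCons v ρ k).Agree Γ (Matrix.vecCons v ρ' k)) .rfl h k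

mutual

theorem Tm.den_congr : ∀ {n : ℕ} (t : Tm S n) {ρ ρ' : Fin n → Val S} {Γ : World S},
    (∀ a, t.HasPar a → (η a).Agree Γ (η' a)) → (∀ k, (ρ k).Agree Γ (ρ' k)) →
    Val.Agree Γ (t.den K η ρ) (t.den K η' ρ')
  | _, .bv k, _, _, _, _, hρ => hρ k
  | _, .par a, _, _, _, hη, _ => hη a rfl
  | _, .con _, _, _, _, _, _ => .rfl
  | _, .iota F, _, _, _, hη, hρ => fun _ h₁ _ =>
    and_congr_right fun _ => forall₃_congr fun _ h₂ _ =>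
      have hF := Fml.force_congr F hη (.vecCons hρ) _ (h₁.trans h₂)
      and_congr (imp_congr_right fun _ => hF) (imp_congr_left hF)

theorem Fml.force_congr : ∀ {n : ℕ} (A : Fml S n) {ρ ρ' : Fin n → Val S} {Γ : World S},
    (∀ a, A.HasPar a → (η a).Agree Γ (η' a)) → (∀ k, (ρ k).Agree Γ (ρ' k)) →
    ∀ Γ' ≥ Γ, (A.force K η ρ Γ' ↔ A.force K η' ρ' Γ')
  | _, .bot, _, _, _, _, _ => fun _ _ => Iff.rfl
  | _, .pred _ ts, _, _, _, hη, hρ => fun _ h₁ => NotNot.congr fun _ h₂ =>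
    exists_congr fun c => and_congr_left fun _ => forall_congr' fun k =>
      Tm.den_congr (ts k) (fun a ha => hη a ⟨k, ha⟩) hρ _ (h₁.trans h₂) (c k)
  | _, .ex t, _, _, _, hη, hρ => fun _ h₁ => NotNot.congr fun _ h₂ =>
    exists_congr (Tm.den_congr t hη hρ _ (h₁.trans h₂))
  | _, .eq s t, _, _, _, hη, hρ => fun _ h₁ => NotNot.congr fun _ h₂ =>
    exists_congr fun c => and_congr
      (Tm.den_congr s (fun a ha => hη a (.inl ha)) hρ _ (h₁.trans h₂) c)
      (Tm.den_congr t (fun a ha => hη a (.inr ha)) hρ _ (h₁.trans h₂) c)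
  | _, .imp A B, _, _, _, hη, hρ => fun _ h₁ => forall₂_congr fun _ h₂ => imp_congr
      (Fml.force_congr A (fun a ha => hη a (.inl ha)) hρ _ (h₁.trans h₂))
      (Fml.force_congr B (fun a ha => hη a (.inr ha)) hρ _ (h₁.trans h₂))
  | _, .all A, _, _, _, hη, hρ => fun _ h₁ => forall₄_congr fun _ h₂ _ _ =>
      Fml.force_congr A hη (.vecCons hρ) _ (h₁.trans h₂)

end

theorem vecCons_comp_liftRen {α : Type*} {m n : ℕ} (v : α) (ρ : Fin n → α) (f : Fin m → Fin n) :
    vecCons v ρ ∘ liftRen f = vecCons v (ρ ∘ f) :=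
  funext <| Fin.cases rfl fun _ => rfl

mutual

theorem Tm.den_ren : ∀ {m : ℕ} (t : Tm S m) {n : ℕ} (f : Fin m → Fin n) (ρ : Fin n → Val S),
    (t.ren f).den K η ρ = t.den K η (ρ ∘ f)
  | _, .bv _, _, _, _ => rfl
  | _, .par _, _, _, _ => rfl
  | _, .con _, _, _, _ => rfl
  | _, .iota F, _, _, _ => by simp only [Tm.ren, Tm.den, Fml.force_ren F, vecCons_comp_liftRen]

theorem Fml.force_ren : ∀ {m : ℕ} (A : Fml S m) {n : ℕ} (f : Fin m → Fin n) (ρ : Fin n → Val S),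
    (A.ren f).force K η ρ = A.force K η (ρ ∘ f)
  | _, .bot, _, _, _ => rfl
  | _, .pred _ ts, _, f, ρ => by simp only [Fml.ren, Fml.force, fun k => Tm.den_ren (ts k) f ρ]
  | _, .ex t, _, _, _ => by simp only [Fml.ren, Fml.force, Tm.den_ren t]
  | _, .eq s t, _, _, _ => by simp only [Fml.ren, Fml.force, Tm.den_ren s, Tm.den_ren t]
  | _, .imp A B, _, _, _ => by simp only [Fml.ren, Fml.force, Fml.force_ren A, Fml.force_ren B]
  | _, .all A, _, _, _ => by simp only [Fml.ren, Fml.force, Fml.force_ren A, vecCons_comp_liftRen]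

end

theorem den_liftSub {m n : ℕ} (f : Fin m → Tm S n) (v : Val S) (ρ : Fin n → Val S) :
    (fun k => (liftSub f k).den K η (vecCons v ρ)) = vecCons v fun k => (f k).den K η ρ :=
  funext <| Fin.cases rfl fun k => Tm.den_ren (f k) Fin.succ _

mutual

theorem Tm.den_subst : ∀ {m : ℕ} (t : Tm S m) {n : ℕ} (f : Fin m → Tm S n) (ρ : Fin n → Val S),
    (t.subst f).den K η ρ = t.den K η fun k => (f k).den K η ρ
  | _, .bv _, _, _, _ => rfl
  | _, .par _, _, _, _ => rfl
  | _, .con _, _, _, _ => rfl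
  | _, .iota F, _, _, _ => by simp only [Tm.subst, Tm.den, Fml.force_subst F, den_liftSub]

theorem Fml.force_subst : ∀ {m : ℕ} (A : Fml S m) {n : ℕ} (f : Fin m → Tm S n)
    (ρ : Fin n → Val S), (A.subst f).force K η ρ = A.force K η fun k => (f k).den K η ρ
  | _, .bot, _, _, _ => rfl
  | _, .pred _ ts, _, f, ρ => by
    simp only [Fml.subst, Fml.force, fun k => Tm.den_subst (ts k) f ρ]
  | _, .ex t, _, _, _ => by simp only [Fml.subst, Fml.force, Tm.den_subst t]
  | _, .eq s t, _, _, _ => by simp only [Fml.subst, Fml.force, Tm.den_subst s, Tm.den_subst t]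
  | _, .imp A B, _, _, _ => by
    simp only [Fml.subst, Fml.force, Fml.force_subst A, Fml.force_subst B]
  | _, .all A, _, _, _ => by simp only [Fml.subst, Fml.force, Fml.force_subst A, den_liftSub]

end

theorem Fml.force_inst (A : Fml S 1) (t : Tm S 0) :
    (A.inst t).force K η ![] = A.force K η ![t.den K η ![]] := by
  rw [Fml.inst, Fml.force_subst, ← Matrix.cons_fin_one]

section Update

variable {n : ℕ} {a : ℕ} {v : Val S} {ρ : Fin n → Val S}

theorem Val.agree_update {b : ℕ} (hb : b ≠ a) : (Function.update η a v b).Agree Γ (η b) := by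
  rw [Function.update_of_ne hb]
  exact .rfl

theorem Fml.force_update {A : Fml S n} (ha : ¬ A.HasPar a) :
    A.force K (Function.update η a v) ρ Γ ↔ A.force K η ρ Γ :=
  A.force_congr (fun _ hb => Val.agree_update (by rintro rfl; exact ha hb)) (fun _ => .rfl) Γ le_rfl

theorem Tm.den_update {t : Tm S n} (ha : ¬ t.HasPar a) {c : Atom S} :
    t.den K (Function.update η a v) ρ Γ c ↔ t.den K η ρ Γ c :=
  t.den_congr (fun _ hb => Val.agree_update (by rintro rfl; exact ha hb)) (fun _ => .rfl) Γ le_rfl c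

theorem Fml.force_inst_par_update {A : Fml S 1} (ha : ¬ A.HasPar a) :
    (A.inst (.par a)).force K (Function.update η a v) ![] Γ ↔ A.force K η ![v] Γ := by
  rw [Fml.force_inst, Fml.force_update ha, Tm.den, Function.update_self]

end Update

/-! ### Proper values -/

/-- The values that arise from terms: at each world they consist of existing objects, all identical
with each other; in inconsistent worlds they contain every object. -/
structure Val.IsProper (K : ℕ) (v : Val S) : Prop where
  ex : ∀ {Γ c}, v Γ c → Nf K Γ.1 (.ex c.1)
  iff_eqAt : ∀ {Γ c}, v Γ c → ∀ Γ' ≥ Γ, ∀ d, v Γ' d ↔ EqAt K Γ' c d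
  of_bot : ∀ {Γ}, Nf K Γ.1 .bot → ∀ c, v Γ c

namespace Val.IsProper

variable {v : Val S} {c : Atom S}

theorem mono (hv : v.IsProper K) (hc : v Γ c) (hΓ : Γ ≤ Γ') : v Γ' c :=
  (hv.iff_eqAt hc _ hΓ c).2 (.refl ((hv.ex hc).mono hΓ))

theorem agree_val (hv : v.IsProper K) (hc : v Γ c) : v.Agree Γ (c.val K) := hv.iff_eqAt hc

end Val.IsProper

theorem Atom.isProper_val (c : Atom S) : (c.val K).IsProper K where
  ex h := h.2.2
  iff_eqAt h _ hΓ _ := ⟨(h.mono hΓ).symm.trans, (h.mono hΓ).trans⟩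
  of_bot h _ := .of_bot h

theorem Val.isProper_desc {Φ : Atom S → World S → Prop}
    (hΦ : ∀ {u Γ}, Nf K Γ.1 .bot → Φ u Γ) : (Val.desc K Φ).IsProper K where
  ex h := h.1
  iff_eqAt {_ c} h Γ' hΓ d := by
    refine ⟨fun hd => ?_, fun hcd => ⟨hcd.2.2, fun Γ₂ hΓ₂ u => ?_⟩⟩
    · have hc := h.1.mono hΓ
      exact (hd.2 Γ' le_rfl c).2 ((h.2 Γ' hΓ c).1 (.refl hc)) hc
    · obtain ⟨hΦu, heq⟩ := h.2 Γ₂ (hΓ.trans hΓ₂) u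
      exact ⟨fun hud => hΦu (hud.trans (hcd.mono hΓ₂).symm),
        fun hu hex => (heq hu hex).trans (hcd.mono hΓ₂)⟩
  of_bot h c := ⟨Nf.exfalso_prime c.2 h, fun _ hΓ _ =>
    ⟨fun _ => hΦ (h.mono hΓ), fun _ _ => .of_bot (h.mono hΓ)⟩⟩

theorem Tm.isProper_den (hη : ∀ a, (η a).IsProper K) : ∀ {n : ℕ} (t : Tm S n)
    {ρ : Fin n → Val S}, (∀ k, (ρ k).IsProper K) → (t.den K η ρ).IsProper K
  | _, .bv k, _, hρ => hρ k
  | _, .par a, _, _ => hη a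
  | _, .con c, _, _ => Atom.isProper_val ⟨.con c, trivial⟩
  | _, .iota _, _, _ => Val.isProper_desc Fml.force_of_bot

end Forcing

/-! ### Soundness -/

section Soundness

variable {K : ℕ} {η : ℕ → Val S} {Γ : World S} {a : ℕ} {c d : Atom S} {s t u : Tm S 0}
  {A F : Fml S 1}

theorem isProper_update (hη : ∀ b, (η b).IsProper K) (a : ℕ) (c : Atom S) (b : ℕ) :
    (Function.update η a (c.val K) b).IsProper K := by
  obtain rfl | hb := eq_or_ne b a
  · rw [Function.update_self]
    exact c.isProper_val
  · rw [Function.update_of_ne hb]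
    exact hη b

theorem Tm.den_par_update (hc : Nf K Γ.1 (.ex c.1)) :
    (Tm.par a).den K (Function.update η a (c.val K)) ![] Γ c := by
  rw [Tm.den, Function.update_self]
  exact .refl hc

theorem Tm.isProper_den_closed (hη : ∀ b, (η b).IsProper K) (t : Tm S 0) :
    (t.den K η ![]).IsProper K :=
  t.isProper_den hη nofun

theorem Fml.force_inst_iff_of_den (hη : ∀ b, (η b).IsProper K) (hc : t.den K η ![] Γ c) :
    (A.inst t).force K η ![] Γ ↔ A.force K η ![c.val K] Γ := by
  rw [Fml.force_inst]
  exact A.force_congr (fun _ _ => .rfl)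
    (Fin.forall_fin_one.2 ((t.isProper_den_closed hη).agree_val hc)) Γ le_rfl

theorem Fml.force_ex_of_den (hη : ∀ b, (η b).IsProper K) (hc : t.den K η ![] Γ c) :
    (Fml.ex t).force K η ![] Γ :=
  NotNot.intro fun _ hΓ => ⟨c, (t.isProper_den_closed hη).mono hc hΓ⟩

theorem Fml.force_eq_iff_of_den (hη : ∀ b, (η b).IsProper K) (hc : s.den K η ![] Γ c)
    (hd : t.den K η ![] Γ d) : (Fml.eq s t).force K η ![] Γ ↔ EqAt K Γ c d := by
  have hs := s.isProper_den_closed hη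
  have ht := t.isProper_den_closed hη
  refine ⟨fun h => .of_notNot (h.imp fun Γ' hΓ ⟨e, hse, hte⟩ => ?_), fun h =>
    NotNot.intro fun Γ' hΓ => ⟨d, (hs.iff_eqAt hc Γ' hΓ d).2 (h.mono hΓ), ht.mono hd hΓ⟩⟩
  exact ((hs.iff_eqAt hc Γ' hΓ e).1 hse).trans ((ht.iff_eqAt hd Γ' hΓ e).1 hte).symm

theorem Fml.force_allE (hη : ∀ b, (η b).IsProper K) (hA : (Fml.all A).force K η ![] Γ)
    (hex : (Fml.ex t).force K η ![] Γ) : (A.inst t).force K η ![] Γ :=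
  Fml.force_bind hex fun Γ' hΓ ⟨c, hc⟩ =>
    (Fml.force_inst_iff_of_den hη hc).2 (hA Γ' hΓ c ((t.isProper_den_closed hη).ex hc))

theorem Fml.force_eqI {C : Fml S 0} (hη : ∀ b, (η b).IsProper K) (ht : ¬ t.HasPar a)
    (hC : ¬ C.HasPar a) (hex : (Fml.ex t).force K η ![] Γ)
    (h : ∀ d : Atom S, ∀ Γ' ≥ Γ,
      (Fml.eq (.par a) t).force K (Function.update η a (d.val K)) ![] Γ' →
        C.force K (Function.update η a (d.val K)) ![] Γ') :
    C.force K η ![] Γ :=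
  Fml.force_bind hex fun Γ' hΓ ⟨d, hd⟩ =>
    have hex := (t.isProper_den_closed hη).ex hd
    (Fml.force_update hC).1 <| h d Γ' hΓ <|
      (Fml.force_eq_iff_of_den (isProper_update hη a d) (Tm.den_par_update hex)
        ((Tm.den_update ht).2 hd)).2 (.refl hex)

theorem Fml.force_eqE (hη : ∀ b, (η b).IsProper K) (hst : (Fml.eq s t).force K η ![] Γ)
    (hs : (A.inst s).force K η ![] Γ) : (A.inst t).force K η ![] Γ :=
  Fml.force_bind hst fun _ hΓ ⟨_, hsc, htc⟩ => (Fml.force_inst_iff_of_den hη htc).2 <|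
    (Fml.force_inst_iff_of_den hη hsc).1 ((A.inst s).force_mono hs hΓ)

theorem Fml.force_ex_of_hasArg {A : Fml S 0} (hA : A.HasArg t) (h : A.force K η ![] Γ) :
    (Fml.ex t).force K η ![] Γ := by
  cases A with
  | pred R ts =>
    obtain ⟨k, rfl⟩ := hA
    exact h.imp fun _ _ ⟨c, hc, _⟩ => ⟨c k, hc k⟩
  | eq s u =>
    obtain rfl | rfl := hA
    · exact h.imp fun _ _ ⟨c, hc, _⟩ => ⟨c, hc⟩
    · exact h.imp fun _ _ ⟨c, _, hc⟩ => ⟨c, hc⟩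
  | _ => exact hA.elim

theorem Fml.force_iotaI (hη : ∀ b, (η b).IsProper K) (hF : ¬ F.HasPar a) (ht : ¬ t.HasPar a)
    (hex : (Fml.ex t).force K η ![] Γ)
    (hFa : ∀ d : Atom S, ∀ Γ' ≥ Γ,
      (Fml.eq (.par a) t).force K (Function.update η a (d.val K)) ![] Γ' →
        (F.inst (.par a)).force K (Function.update η a (d.val K)) ![] Γ')
    (hat : ∀ d : Atom S, ∀ Γ' ≥ Γ,
      (F.inst (.par a)).force K (Function.update η a (d.val K)) ![] Γ' →
        (Fml.ex (.par a)).force K (Function.update η a (d.val K)) ![] Γ' →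
          (Fml.eq (.par a) t).force K (Function.update η a (d.val K)) ![] Γ') :
    (Fml.eq (.iota F) t).force K η ![] Γ := by
  refine hex.imp fun Γ' hΓ ⟨c, hc⟩ =>
    ⟨c, ⟨(t.isProper_den_closed hη).ex hc, fun Γ₂ hΓ₂ d => ?_⟩, hc⟩
  have hη' := isProper_update hη a d
  have eq_iff (hd : Nf K Γ₂.1 (.ex d.1)) :
      (Fml.eq (.par a) t).force K (Function.update η a (d.val K)) ![] Γ₂ ↔ EqAt K Γ₂ d c :=
    Fml.force_eq_iff_of_den hη' (Tm.den_par_update hd)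
      ((Tm.den_update ht).2 ((t.isProper_den_closed hη).mono hc hΓ₂))
  refine ⟨fun hdc => ?_, fun hFd hd => ?_⟩
  · exact (Fml.force_inst_par_update hF).1 (hFa d Γ₂ (hΓ.trans hΓ₂) ((eq_iff hdc.2.1).2 hdc))
  · exact (eq_iff hd).1 <| hat d Γ₂ (hΓ.trans hΓ₂) ((Fml.force_inst_par_update hF).2 hFd)
      (Fml.force_ex_of_den hη' (Tm.den_par_update hd))

theorem Fml.force_iotaE₁ (hη : ∀ b, (η b).IsProper K) (hF : (Fml.eq (.iota F) t).force K η ![] Γ)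
    (hut : (Fml.eq u t).force K η ![] Γ) : (F.inst u).force K η ![] Γ :=
  Fml.force_bind hF fun _ hΓ ⟨_, hFc, htc⟩ =>
    Fml.force_bind (hut.mono hΓ) fun Γ₂ hΓ₂ ⟨d, hud, htd⟩ =>
      have hcd := ((t.isProper_den_closed hη).iff_eqAt htc Γ₂ hΓ₂ d).1 htd
      (Fml.force_inst_iff_of_den hη hud).2 ((hFc.2 Γ₂ hΓ₂ d).1 hcd.symm)

theorem Fml.force_iotaE₂ (hη : ∀ b, (η b).IsProper K) (hF : (Fml.eq (.iota F) t).force K η ![] Γ)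
    (hFu : (F.inst u).force K η ![] Γ) (hex : (Fml.ex u).force K η ![] Γ) :
    (Fml.eq u t).force K η ![] Γ := by
  refine Fml.force_bind hF fun Γ' hΓ ⟨c, hFc, htc⟩ => ?_
  refine Fml.force_bind (hex.mono hΓ) fun Γ₂ hΓ₂ ⟨d, hud⟩ => ?_
  have hFd := (Fml.force_inst_iff_of_den hη hud).1 ((F.inst u).force_mono hFu (hΓ.trans hΓ₂))
  have hdc := (hFc.2 Γ₂ hΓ₂ d).2 hFd ((u.isProper_den_closed hη).ex hud)
  exact (Fml.force_eq_iff_of_den hη hud ((t.isProper_den_closed hη).mono htc hΓ₂)).2 hdc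

theorem Rule.Ok.force_concl {r : Rule S} (hok : r.Ok) (hη : ∀ b, (η b).IsProper K)
    (hasm : ∀ i A, r = .asm i A → A.force K η ![] Γ)
    (hprem : ∀ (n : Fin r.prems.length) (η' : ℕ → Val S), (∀ b, (η' b).IsProper K) →
      (∀ b, r.eigen n ≠ some b → η' b = η b) → ∀ Γ' ≥ Γ,
        (∀ c ∈ r.disch n, c.2.force K η' ![] Γ') → (r.prems.get n).force K η' ![] Γ') :
    r.concl.force K η ![] Γ := by
  have plain (n : Fin r.prems.length) := hprem n η hη fun _ _ => rfl
  have closed (n : Fin r.prems.length) (hn : r.disch n = ∅) : (r.prems.get n).force K η ![] Γ :=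
    plain n Γ le_rfl fun c hc => (hn ▸ hc : c ∈ (∅ : Set _)).elim
  have updated (n : Fin r.prems.length) (a : ℕ) (ha : r.eigen n = some a) (d : Atom S) :=
    hprem n (Function.update η a (d.val K)) (isProper_update hη a d) fun b hb =>
      Function.update_of_ne (by rintro rfl; exact hb ha) _ _
  cases r with
  | asm i A => exact hasm i A rfl
  | impI i A B => exact fun Γ' hΓ hA => plain (0 : Fin 1) Γ' hΓ (by rintro _ rfl; exact hA)
  | impE A B => exact closed (0 : Fin 2) rfl Γ le_rfl (closed (1 : Fin 2) rfl)
  | botC i A =>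
    exact A.force_of_notNot fun Γ' hΓ hA => plain (0 : Fin 1) Γ' hΓ (by rintro _ rfl; exact hA)
  | allI i a A =>
    exact fun Γ' hΓ d hd => (Fml.force_inst_par_update hok).1 <|
      updated (0 : Fin 1) a rfl d Γ' hΓ (by
        rintro _ rfl
        exact Fml.force_ex_of_den (isProper_update hη a d) (Tm.den_par_update hd))
  | allE A t => exact Fml.force_allE hη (closed (0 : Fin 2) rfl) (closed (1 : Fin 2) rfl)
  | eqI i a t C =>
    exact Fml.force_eqI hη hok.1 hok.2 (closed (0 : Fin 2) rfl) fun d Γ' hΓ h =>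
      updated (1 : Fin 2) a rfl d Γ' hΓ (by rintro _ rfl; exact h)
  | eqE A s t => exact Fml.force_eqE hη (closed (0 : Fin 2) rfl) (closed (1 : Fin 2) rfl)
  | ad A t => exact Fml.force_ex_of_hasArg hok.1 (closed (0 : Fin 1) rfl)
  | iotaI i j k a F t =>
    exact Fml.force_iotaI hη hok.2.1 hok.2.2 (closed (0 : Fin 3) rfl)
      (fun d Γ' hΓ h => updated (1 : Fin 3) a rfl d Γ' hΓ (by rintro _ rfl; exact h))
      fun d Γ' hΓ hF hex => updated (2 : Fin 3) a rfl d Γ' hΓ (by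
        rintro _ (rfl | rfl)
        exacts [hF, hex])
  | iotaE₁ F t u => exact Fml.force_iotaE₁ hη (closed (0 : Fin 2) rfl) (closed (1 : Fin 2) rfl)
  | iotaE₂ F t u =>
    exact Fml.force_iotaE₂ hη (closed (0 : Fin 3) rfl) (closed (1 : Fin 3) rfl)
      (closed (2 : Fin 3) rfl)
  | iotaE₃ F t =>
    exact Fml.force_ex_of_hasArg (A := .eq (.iota F) t) (.inr rfl) (closed (0 : Fin 1) rfl)

theorem Ded.Correct.force : ∀ {D : Ded S}, D.Correct → ∀ {η : ℕ → Val S},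
    (∀ b, (η b).IsProper K) → ∀ {Γ : World S}, (∀ c ∈ D.openAsm, c.2.force K η ![] Γ) →
      D.concl.force K η ![] Γ
  | .node r ds, ⟨hcor, hconcl, hok, heigen, _⟩, η, hη, Γ, hΓ => by
    refine hok.force_concl hη (fun i A h => hΓ (i, A) (.inl h)) fun n η' hη' heq Γ' hΓ' hdisch => ?_
    rw [← hconcl n]
    refine (hcor n).force hη' fun c hc => ?_
    by_cases hcd : c ∈ r.disch n
    · exact hdisch c hcd
    · have agree (b : ℕ) (hb : c.2.HasPar b) : (η' b).Agree Γ' (η b) := by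
        rw [heq b fun h => heigen n b h c hc hcd hb]
        exact .rfl
      rw [c.2.force_congr agree (fun _ => .rfl) Γ' le_rfl]
      exact c.2.force_mono (hΓ c (.inr (Set.mem_iUnion.2 ⟨n, hc, hcd⟩))) hΓ'

end Soundness

/-! ### Completeness -/

section Completeness

variable {K n : ℕ} {Γ : World S} {P Q : World S → Prop} {A B : Fml S 0}

theorem World.neu_ins (K : ℕ) (A : Fml S 0) (Γ : World S) : Neu K (Γ.ins (K + 2, A)).1 A :=
  Neu.asm (World.mem_ins _ _) (by omega) (by omega)

theorem NotNot.of_name {t : Tm S 0} (ht : Nf K Γ.1 (.ex t))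
    (h : ∀ Γ' ≥ Γ, ∀ a, IsName K Γ'.1 a t → P Γ') : NotNot K P Γ := by
  intro Γ' hΓ hP
  obtain ⟨a, haΓ, hat⟩ := exists_fresh Γ'.2 (Fml.ex t)
  have hle := Γ'.le_ins (K + 1, .eq (.par a) t)
  have hname : IsName K (Γ'.ins (K + 1, .eq (.par a) t)).1 a t := ⟨World.mem_ins _ _, hat⟩
  exact Nf.eqI hat haΓ (ht.mono hΓ) (hP _ hle (h _ (hΓ.trans hle) a hname))

theorem NotNot.of_names : ∀ {n : ℕ} {s : Fin n → Tm S 0} {Γ : World S},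
    (∀ i, Nf K Γ.1 (.ex (s i))) →
    (∀ Γ' ≥ Γ, ∀ a : Fin n → ℕ, (∀ i, IsName K Γ'.1 (a i) (s i)) → P Γ') → NotNot K P Γ
  | 0, _, _, _, h => .intro fun Γ' hΓ => h Γ' hΓ nofun nofun
  | _ + 1, _, _, hs, h =>
    (NotNot.of_name (P := fun Γ' => ∃ a, IsName K Γ'.1 a _) (hs 0) fun _ _ a ha => ⟨a, ha⟩).bind
      fun _ hΓ ⟨a, ha⟩ => of_names (fun i => (hs i.succ).mono hΓ) fun Γ₂ hΓ₂ b hb =>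
        h Γ₂ (hΓ.trans hΓ₂) (Fin.cons a b) (Fin.cases ⟨hΓ₂ ha.1, ha.2⟩ hb)

/-- The condition `P` represents the formula `A`: it can be read back as a normal deduction of `A`,
and every neutral deduction of `A` establishes it. -/
structure Represents (K : ℕ) (P : World S → Prop) (A : Fml S 0) : Prop where
  reify : ∀ {Γ}, P Γ → Nf K Γ.1 A
  reflect : ∀ {Γ}, Neu K Γ.1 A → P Γ

/-- The value `v` represents the term `t`: the objects it contains are derivably identical with `t`,
and it contains every name of `t`, provided `t` exists. -/
structure Val.Represents (K : ℕ) (v : Val S) (t : Tm S 0) : Prop where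
  nf_eq : ∀ {Γ c}, v Γ c → Nf K Γ.1 (.eq t c.1)
  nf_ex : ∀ {Γ c}, v Γ c → Nf K Γ.1 (.ex t)
  reflect : ∀ {Γ a}, IsName K Γ.1 a t → Nf K Γ.1 (.ex t) → v Γ (Atom.par a)

theorem Atom.represents_val (c : Atom S) : (c.val K).Represents K c.1 where
  nf_eq h := h.1
  nf_ex h := h.2.1
  reflect {Γ _} ha hex := ⟨ha.nf_eq.symm Γ.2 ha.nf_ex, hex, ha.nf_ex⟩

section Description

variable {Φ : Atom S → World S → Prop} {F : Fml S 1}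

theorem Val.exists_iotaI_of_desc (h : ∀ u : Atom S, NFL.Represents K (Φ u) (F.inst u.1))
    {c : Atom S} (hc : Val.desc K Φ Γ c) :
    ∃ i j k a, Der K (· = .iotaI i j k a F c.1) ∅ Γ.1 (.eq (.iota F) c.1) := by
  obtain ⟨hex, hdesc⟩ := hc
  obtain ⟨a, haΓ, ha⟩ := exists_fresh Γ.2 (Fml.eq (.iota F) c.1)
  refine ⟨K + 2, K + 2, K + 2, a, Der.iotaI c.2 (fun hF => ha (.inl hF)) (fun hc => ha (.inr hc))
    haΓ hex ?_ ?_⟩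
  · have hne := Γ.neu_ins K (.eq (.par a) c.1)
    exact (h (Atom.par a)).reify <| (hdesc _ (World.le_ins _ _) (Atom.par a)).1
      ⟨hne.nf, hne.ex_left, hne.ex_right⟩
  · have hΦ := (h (Atom.par a)).reflect <|
      (Γ.ins (K + 2, .ex (.par a))).neu_ins K (F.inst (.par a))
    have hpar := (Γ.neu_ins K (.ex (.par a))).nf.mono (World.le_ins (K + 2, F.inst (.par a)) _)
    exact ((hdesc _ ((World.le_ins _ _).trans (World.le_ins _ _)) (Atom.par a)).2 hΦ hpar).1

theorem IsName.major_iota {a : ℕ} (ha : IsName K Γ.1 a (.iota F)) :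
    Major K Γ.1 (.eq (.iota F) (.par a)) :=
  Major.eqE (A := .eq (.bv 0) (.par a)) (s := .par a) (t := .iota F) trivial nofun nofun ha.nf_eq
    (ha.nf_ex.refl Γ.2)

theorem Val.represents_desc (h : ∀ u : Atom S, NFL.Represents K (Φ u) (F.inst u.1)) :
    (Val.desc K Φ).Represents K (.iota F) where
  nf_eq hc :=
    let ⟨_, _, _, _, hder⟩ := exists_iotaI_of_desc h hc
    hder.imp_rule fun _ hr => hr ▸ nofun
  nf_ex {_ c} hc :=
    let ⟨_, _, _, _, hder⟩ := exists_iotaI_of_desc h hc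
    Nf.ex_iota c.2 hder
  reflect {Γ a} ha _ := by
    refine ⟨ha.nf_ex, fun Γ' hΓ u => ⟨fun hua => ?_, fun hu hex => ?_⟩⟩
    · exact (h u).reflect (Neu.iotaE₁ (Atom.par a).2 u.2 (ha.major_iota.mono hΓ) hua.1)
    · exact ⟨(Neu.iotaE₂ (Atom.par a).2 u.2 (ha.major_iota.mono hΓ) ((h u).reify hu) hex).nf, hex,
        ha.nf_ex.mono hΓ⟩

end Description

namespace Represents

theorem bot : Represents (S := S) K (fun Γ => Nf K Γ.1 .bot) .bot := ⟨id, Neu.nf⟩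

theorem pred {R : S.Pred} {v : Fin (S.ar R) → Val S} {ts : Fin (S.ar R) → Tm S 0}
    (hv : ∀ k, (v k).IsProper K) (h : ∀ k, (v k).Represents K (ts k)) :
    Represents K (NotNot K fun Γ => ∃ c : Fin (S.ar R) → Atom S,
      (∀ k, v k Γ (c k)) ∧ Nf K Γ.1 (.pred R fun k => (c k).1)) (.pred R ts) where
  reify hR := hR.nf trivial
    (fun hbot => ⟨fun _ => Atom.par 0, fun k => (hv k).of_bot hbot _,
      hbot.exfalso_prime fun _ => trivial⟩)
    fun Γ _ ⟨_, hc, hcR⟩ =>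
      hcR.pred_replace fun k => ((h k).nf_eq (hc k)).symm Γ.2 ((h k).nf_ex (hc k))
  reflect hR :=
    have hex k := Neu.ad (A := .pred R ts) ⟨k, rfl⟩ hR
    NotNot.of_names hex fun Γ hΓ a ha =>
      ⟨fun k => Atom.par (a k), fun k => (h k).reflect (ha k) ((hex k).mono hΓ),
        Nf.pred_replace (fun k => (ha k).nf_eq.symm Γ.2 (ha k).nf_ex) (hR.nf.mono hΓ)⟩

theorem ex {v : Val S} {t : Tm S 0} (hv : v.IsProper K) (h : v.Represents K t) :
    Represents K (NotNot K fun Γ => ∃ c, v Γ c) (.ex t) where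
  reify ht := ht.nf trivial (fun hbot => ⟨Atom.par 0, hv.of_bot hbot _⟩)
    fun _ _ ⟨_, hc⟩ => h.nf_ex hc
  reflect ht := NotNot.of_name ht.nf fun _ hΓ _ ha => ⟨_, h.reflect ha (ht.nf.mono hΓ)⟩

theorem eq {v w : Val S} {s t : Tm S 0} (hv : v.IsProper K) (hw : w.IsProper K)
    (hs : v.Represents K s) (ht : w.Represents K t) :
    Represents K (NotNot K fun Γ => ∃ c, v Γ c ∧ w Γ c) (.eq s t) where
  reify hst := hst.nf trivial (fun hbot => ⟨Atom.par 0, hv.of_bot hbot _, hw.of_bot hbot _⟩)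
    fun Γ _ ⟨_, hsc, htc⟩ =>
      ((ht.nf_eq htc).symm Γ.2 (ht.nf_ex htc)).eq_replace_right (hs.nf_eq hsc)
  reflect {Γ} hst := by
    have hex : ∀ i, Nf K Γ.1 (.ex (![s, t] i)) := Fin.forall_fin_two.2
      ⟨hst.ex_left, hst.ex_right⟩
    refine NotNot.of_names hex fun Γ' hΓ a ha => ?_
    have has : IsName K Γ'.1 (a 0) s := ha 0
    have hbt : IsName K Γ'.1 (a 1) t := ha 1
    have hsa := hs.reflect has ((hex 0).mono hΓ)
    have htb := ht.reflect hbt ((hex 1).mono hΓ)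
    have hat := Nf.eq_replace_right (hst.nf.mono hΓ) has.nf_eq
    have hab := (hbt.nf_eq.symm Γ'.2 hbt.nf_ex).eq_replace_right hat
    have heq : EqAt K Γ' (Atom.par (a 0)) (Atom.par (a 1)) := ⟨hab, has.nf_ex, hbt.nf_ex⟩
    exact ⟨_, hsa, (hw.iff_eqAt htb Γ' le_rfl _).2 heq.symm⟩

theorem imp (hA : Represents K P A) (hB : Represents K Q B) :
    Represents K (fun Γ => ∀ Γ' ≥ Γ, P Γ' → Q Γ') (.imp A B) where
  reify {Γ} h := Nf.impI <| hB.reify <| h _ (Γ.le_ins _) (hA.reflect (Γ.neu_ins K A))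
  reflect h _ hΓ hP := hB.reflect (Neu.impE (h.major.mono hΓ) (hA.reify hP))

theorem all {Φ : Atom S → World S → Prop} {A : Fml S 1}
    (h : ∀ u : Atom S, Represents K (Φ u) (A.inst u.1)) :
    Represents K (fun Γ => ∀ Γ' ≥ Γ, ∀ u : Atom S, Nf K Γ'.1 (.ex u.1) → Φ u Γ') (.all A) where
  reify {Γ} hΦ := by
    obtain ⟨a, haΓ, haA⟩ := exists_fresh Γ.2 A
    exact Nf.allI haA haΓ <| (h (Atom.par a)).reify <|
      hΦ _ (Γ.le_ins _) (Atom.par a) (Γ.neu_ins K (.ex (.par a))).nf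
  reflect hA _ hΓ u hu := (h u).reflect (Neu.allE u.2 (hA.major.mono hΓ) hu)

end Represents

theorem comp_vecCons {α β : Type*} (g : α → β) (x : α) (f : Fin n → α) :
    (fun k => g (vecCons x f k)) = vecCons (g x) fun k => g (f k) :=
  Fin.comp_cons g x f

theorem Represents.force_inst {η : ℕ → Val S} {A : Fml S (n + 1)} {f : Fin n → Atom S} {u : Atom S}
    (h : Represents K (A.force K η fun k => (vecCons u f k).val K)
      (A.subst fun k => (vecCons u f k).1)) :
    Represents K (A.force K η (vecCons (u.val K) fun k => (f k).val K))
      ((A.subst (liftSub fun k => (f k).1)).inst u.1) := by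
  rwa [Fml.subst_liftSub_inst, ← comp_vecCons (Atom.val K), ← comp_vecCons Subtype.val]

/-- The valuation of the canonical model, in which every parameter denotes itself. -/
def parVal (K : ℕ) (a : ℕ) : Val S := (Atom.par a).val K

theorem isProper_parVal (a : ℕ) : (parVal K a : Val S).IsProper K := (Atom.par a).isProper_val

theorem isProper_den_parVal (t : Tm S n) (f : Fin n → Atom S) :
    (t.den K (parVal K) fun k => (f k).val K).IsProper K :=
  t.isProper_den isProper_parVal fun k => (f k).isProper_val

mutual

theorem Tm.represents_den : ∀ {n : ℕ} (t : Tm S n) (f : Fin n → Atom S),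
    (t.den K (parVal K) fun k => (f k).val K).Represents K (t.subst fun k => (f k).1)
  | _, .bv k, f => (f k).represents_val
  | _, .par a, _ => (Atom.par a).represents_val
  | _, .con c, _ => Atom.represents_val ⟨.con c, trivial⟩
  | _, .iota F, f => Val.represents_desc fun u => (F.represents_force (vecCons u f)).force_inst

theorem Fml.represents_force : ∀ {n : ℕ} (A : Fml S n) (f : Fin n → Atom S),
    Represents K (A.force K (parVal K) fun k => (f k).val K) (A.subst fun k => (f k).1)
  | _, .bot, _ => .bot
  | _, .pred _ ts, f => .pred (fun k => isProper_den_parVal (ts k) f)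
      fun k => (ts k).represents_den f
  | _, .ex t, f => .ex (isProper_den_parVal t f) (t.represents_den f)
  | _, .eq s t, f => .eq (isProper_den_parVal s f) (isProper_den_parVal t f) (s.represents_den f)
      (t.represents_den f)
  | _, .imp A B, f => .imp (A.represents_force f) (B.represents_force f)
  | _, .all A, f => .all fun u => (A.represents_force (vecCons u f)).force_inst

end

theorem Fml.represents_force_closed (A : Fml S 0) :
    Represents K (A.force K (parVal K) ![]) A := by
  simpa only [Fml.subst_closed, Matrix.empty_eq] using A.represents_force (K := K) ![]

/-! ### Normalization -/

theorem Ded.finite_openAsm : ∀ D : Ded S, D.openAsm.Finite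
  | .node _ ds => by
    refine .union (Set.Subsingleton.finite ?_)
      (Set.finite_iUnion fun n => (ds n).finite_openAsm.sdiff)
    rintro ⟨i, A⟩ rfl ⟨j, B⟩ ⟨⟩
    rfl

theorem Ded.Correct.nf {D : Ded S} (hD : D.Correct) (hK : ∀ c ∈ D.openAsm, c.1 < K) :
    Nf K D.openAsm D.concl :=
  D.concl.represents_force_closed.reify (Γ := ⟨D.openAsm, D.finite_openAsm⟩) <|
    hD.force isProper_parVal fun c hc => c.2.represents_force_closed.reflect <|
      Neu.asm hc (hK c hc).ne ((hK c hc).trans K.lt_succ_self).ne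

end Completeness

end NFL

theorem mainTheorem3 (S : NFL.Sig) (D : NFL.Ded S) (hD : D.Correct) :
    ∃ D' : NFL.Ded S, D'.Correct ∧ D'.concl = D.concl ∧ D'.openAsm ⊆ D.openAsm ∧
      D'.Regular ∧ D'.Normal := by
  obtain ⟨m, hm⟩ := (D.finite_openAsm.image Prod.fst).bddAbove
  have label_lt : ∀ c ∈ D.openAsm, c.1 < m + 1 := fun c hc =>
    Nat.lt_succ_of_le (hm (Set.mem_image_of_mem _ hc))
  obtain ⟨D', hcor, hnormal, hconcl, -, -, hopen⟩ := hD.nf label_lt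
  exact ⟨D', hcor, hconcl, hopen, hnormal.regular, hnormal.normal⟩
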